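/- All graphs are finite, with no loops or parallel edges; $\chi(G)$ and $\omega(G)$ denote the chromatic number and the clique number of $G$, and for $X\subseteq V(G)$, $G[X]$ is the subgraph induced on $X$. For an integer $\rho\ge 1$ and a graph $G$, let $\chi^{\rho}(G)$ be the maximum, over all vertices $v$ of $G$, of the chromatic number of the subgraph of $G$ induced on the set of vertices at $G$-distance at most $\rho$ from $v$ (and $\chi^{\rho}(G)=0$ if $G$ is the null graph). For a nondecreasing function $\phi:\mathbb{N}\to\mathbb{N}$, a graph $G$ is $(\rho,\phi)$-controlled if $\chi(H)\le \phi(\chi^{\rho}(H))$ for every induced subgraph $H$ of $G$. For $\ell\ge 4$, an $\ell$-hole in $G$ is an induced subgraph of $G$ that is a cycle of length $\ell$. A hole $H$ in $G$ is $d$-peripheral if $\chi(G[X])>d$, where $X$ is the set of vertices of $G$ that are not in $V(H)$ and have no neighbour in $V(H)$. Theorem. Let $\phi:\mathbb{N}\to\mathbb{N}$ be a nondecreasing function, and let $\rho,\ell,d,\tau$ be nonnegative integers with $\rho\ge 3$ and $\ell\ge 8\rho^2+6\rho$. Then there exists an integer $c\ge 0$ (depending only on $\phi,\rho,\ell,d,\tau$)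 with the following property. Let $G$ be a $(\rho,\phi)$-controlled graph with $\chi(G)>c$ such that $\chi^{\rho-1}(G)\le\tau$, and $\chi(J)\le\tau$ for every induced subgraph $J$ of $G$ with $\omega(J)<\omega(G)$. Then there is a $d$-peripheral $\ell$-hole in $G$. -/

import Mathlib

namespace SimpleGraph

variable {V : Type*}

/-- `N^ρ[v]`: the set of vertices at `G`-distance at most `ρ` from `v`
(vertices in other components are at distance `⊤`). -/
def distBall (G : SimpleGraph V) (ρ : ℕ) (v : V) : Set V :=
  {u | G.edist v u ≤ (ρ : ℕ∞)}

/-- `χ^ρ(G)`: the maximum over all vertices `v` of the chromatic number of the subgraph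
induced on `N^ρ[v]`; it is `0` for the null graph. -/
noncomputable def ballChromaticNumber (G : SimpleGraph V) (ρ : ℕ) : ℕ∞ :=
  ⨆ v : V, (G.induce (G.distBall ρ v)).chromaticNumber

/-- On finite graphs `χ^ρ` is a natural number, so that `ENat.toNat` below loses nothing. -/
theorem ballChromaticNumber_ne_top [Finite V] (G : SimpleGraph V) (ρ : ℕ) :
    G.ballChromaticNumber ρ ≠ ⊤ := by
  have h : G.ballChromaticNumber ρ ≤ (Nat.card V : ℕ∞) := by
    refine iSup_le fun v => ?_
    have := Fintype.ofFinite V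
    have hc : G.Colorable (Nat.card V) := by
      rw [Nat.card_eq_fintype_card]; exact G.colorable_of_fintype
    exact (hc.of_hom (Embedding.induce (G.distBall ρ v)).toHom).chromaticNumber_le
  exact ne_top_of_le_ne_top (ENat.natCast_ne_top _) h

/-- A (finite) graph `G` is `(ρ, φ)`-controlled if `χ(H) ≤ φ(χ^ρ(H))` for every induced
subgraph `H` of `G`. Distances in `χ^ρ(H)` are measured in `H`. -/
def IsControlled (G : SimpleGraph V) (ρ : ℕ) (φ : ℕ → ℕ) : Prop :=
  ∀ S : Set V, (G.induce S).chromaticNumber ≤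
    (φ ((G.induce S).ballChromaticNumber ρ).toNat : ℕ∞)

/-- `C` is the vertex set of an `ℓ`-hole: an induced subgraph that is a cycle of length
`ℓ ≥ 4`. -/
def IsHole (G : SimpleGraph V) (ℓ : ℕ) (C : Set V) : Prop :=
  4 ≤ ℓ ∧ Nonempty (cycleGraph ℓ ≃g G.induce C)

/-- The hole with vertex set `C` is `d`-peripheral: the subgraph induced on the vertices that
are not in `C` and have no neighbour in `C` has chromatic number greater than `d`. -/
def IsPeripheral (G : SimpleGraph V) (d : ℕ) (C : Set V) : Prop :=
  (d : ℕ∞) < (G.induce {x | x ∉ C ∧ ∀ u ∈ C, ¬ G.Adj x u}).chromaticNumber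

end SimpleGraph

namespace PeripheralHoles

open SimpleGraph

section

variable {V : Type*} {G : SimpleGraph V}

/-! ### Colourings of vertex sets -/

/-! Call a vertex set large if it needs many colours. Balls of radius `ρ - 1` are `τ`-colourable,
but by control every large set contains, within the graph it induces, a ball of radius `ρ` that is
large. Most of that ball is therefore at distance exactly `ρ` from its centre, a hub. Repeating this
inside the sphere yields nested hubs `v 0, v 1, …` (`exists_frame`) and a large last set, each of
whose vertices `z` has a leg of length `ρ` to every hub. Two legs of one `z` join two hubs by an
induced path with at most `2ρ` edges. A bounded number of balls cannot exhaust a large set, so new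
pieces can be chosen far from old ones. The dangerous edges that survive run from neighbours of a
hub to vertices at position two of legs. They are avoided by ranking all vertices injectively,
always choosing the first eligible neighbour of the hub, and splitting large sets by the rank of the
chosen neighbour.

Control over lengths comes from maximum cliques (`exists_consecutive_links`). In a large set, the
hubs whose tails have one suitable common pair of lengths form a large set, so they include a
maximum clique `K` of `G`. After shrinking, the chosen neighbours of each `h ∈ K` all have the same
set `S h` of neighbours in `K`. Let `S h₁` be largest. Since `K` is maximum, some `h₂ ∈ K` lies
outside `S h₁`; since `h₂ ∈ S h₂`, there is some `s ∈ S h₁` outside `S h₂`. Two tails meeting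
through one hub have one middle vertex. Tails meeting through `s, h₂` have two, or none if their
ends are already adjacent. Suitable combinations give two links whose lengths differ by one.

Chaining `2ρ + 1` such pairs of links gives paths of `2ρ + 2` consecutive lengths. Single links then
bring the length close to `ℓ`, and a reserved vertex `z` closes the path to an `ℓ`-hole, the spare
lengths absorbing the uncertainty of the closing path. Any `ℓ`-hole is peripheral, because it and
its neighbours lie in `ℓ` balls of bounded chromatic number. -/

/-- The set `S` has a proper colouring with `k` colours. -/
def Col (G : SimpleGraph V) (S : Set V) (k : ℕ) : Prop :=
  ∃ c : V → ℕ, (∀ v ∈ S, c v < k) ∧ ∀ u ∈ S, ∀ v ∈ S, G.Adj u v → c u ≠ c v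

theorem chromaticNumber_induce_le_iff {S : Set V} {k : ℕ} :
    (G.induce S).chromaticNumber ≤ k ↔ Col G S k := by
  rw [chromaticNumber_le_iff_colorable]
  constructor
  · rintro ⟨C⟩
    classical
    refine ⟨fun v => if h : v ∈ S then (C ⟨v, h⟩ : ℕ) else 0, fun v hv => ?_,
      fun u hu v hv huv => ?_⟩
    · simp [hv]
    · simp only [hu, hv, dite_true]
      have : (G.induce S).Adj ⟨u, hu⟩ ⟨v, hv⟩ := huv
      exact fun h => C.valid this (Fin.ext h)
  · rintro ⟨c, hc, hc'⟩
    refine ⟨Coloring.mk (fun v => ⟨c v, hc v v.2⟩) ?_⟩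
    intro u v huv h
    exact hc' u u.2 v v.2 huv (Fin.mk.inj_iff.1 h)

theorem Col.mono {S T : Set V} {k m : ℕ} (h : Col G S k) (hT : T ⊆ S) (hk : k ≤ m) :
    Col G T m := by
  obtain ⟨c, hc, hc'⟩ := h
  exact ⟨c, fun v hv => (hc v (hT hv)).trans_le hk,
    fun u hu v hv => hc' u (hT hu) v (hT hv)⟩

theorem Col.union {S T : Set V} {a b : ℕ} (hS : Col G S a) (hT : Col G T b) :
    Col G (S ∪ T) (a + b) := by
  classical
  obtain ⟨c, hc, hc'⟩ := hS
  obtain ⟨e, he, he'⟩ := hT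
  have hT : ∀ v, v ∈ S ∪ T → v ∉ S → v ∈ T := fun v hv h => hv.resolve_left h
  refine ⟨fun v => if v ∈ S then c v else a + e v, fun v hv => ?_, fun u hu v hv huv => ?_⟩
  · by_cases h : v ∈ S
    · have := hc v h; simp only [h, if_true]; omega
    · have := he v (hT v hv h); simp only [h, if_false]; omega
  · by_cases h : u ∈ S <;> by_cases h' : v ∈ S <;> simp only [h, h', if_true, if_false]
    · exact hc' u h v h' huv
    · have := hc u h; omega
    · have := hc v h'; omega
    · have := he' u (hT u hu h) v (hT v hv h') huv; omega

theorem Col.of_subset_union {S T U : Set V} {a b : ℕ} (hS : Col G S a) (hT : Col G T b)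
    (h : ∀ x ∈ U, x ∈ S ∨ x ∈ T) : Col G U (a + b) :=
  (hS.union hT).mono h le_rfl

theorem Col.of_empty {S : Set V} (h : ∀ x, x ∉ S) (k : ℕ) : Col G S k :=
  ⟨fun _ => 0, fun v hv => (h v hv).elim, fun v hv => (h v hv).elim⟩

theorem nonempty_of_not_col {S : Set V} {k : ℕ} (h : ¬ Col G S k) : ∃ x, x ∈ S := by
  by_contra hn
  exact h (Col.of_empty (fun x hx => hn ⟨x, hx⟩) k)

theorem exists_class_not_col {S : Set V} {n k : ℕ} (h : ¬ Col G S (n * k))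
    (P : ℕ → V → Prop) (hP : ∀ v ∈ S, ∃ i < n, P i v) :
    ∃ i < n, ¬ Col G {v ∈ S | P i v} k := by
  induction n generalizing S with
  | zero =>
    obtain ⟨x, hx⟩ := nonempty_of_not_col h
    obtain ⟨i, hi, -⟩ := hP x hx
    omega
  | succ n ih =>
    by_cases hn : Col G {v ∈ S | P n v} k
    · have h1 : ¬ Col G {v ∈ S | ¬ P n v} (n * k) := by
        intro h2
        refine h ((h2.of_subset_union hn ?_).mono le_rfl (by rw [Nat.succ_mul]))
        intro x hx
        by_cases hx' : P n x
        · exact Or.inr ⟨hx, hx'⟩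
        · exact Or.inl ⟨hx, hx'⟩
      obtain ⟨i, hi, hc⟩ := ih h1 (by
        rintro v ⟨hv, hv'⟩
        obtain ⟨i, hi, h3⟩ := hP v hv
        refine ⟨i, ?_, h3⟩
        rcases Nat.lt_succ_iff_lt_or_eq.1 hi with h4 | h4
        · exact h4
        · exact (hv' (h4 ▸ h3)).elim)
      exact ⟨i, by omega, fun h4 => hc (h4.mono (fun x hx => ⟨hx.1.1, hx.2⟩) le_rfl)⟩
    · exact ⟨n, by omega, hn⟩

theorem not_col_or {S : Set V} {a b : ℕ} (h : ¬ Col G S (a + b)) (P : V → Prop) :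
    ¬ Col G {v ∈ S | P v} a ∨ ¬ Col G {v ∈ S | ¬ P v} b := by
  by_contra hn
  push Not at hn
  refine h (hn.1.of_subset_union hn.2 fun x hx => ?_)
  by_cases hx' : P x
  · exact Or.inl ⟨hx, hx'⟩
  · exact Or.inr ⟨hx, hx'⟩

/-- Take the least `t` whose lower part is not `a`-colourable. Strictly below `t` there are `a`
colours, level `t` costs `τ`, and so the part above `t` cannot be `b`-colourable. -/
theorem not_col_split [Finite V] {S : Set V} {a b τ : ℕ} (f : V → ℕ)
    (hf : ∀ m, Col G {z ∈ S | f z = m} τ) (h : ¬ Col G S (a + τ + b)) :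
    ∃ t, ¬ Col G {z ∈ S | f z ≤ t} a ∧ ¬ Col G {z ∈ S | t < f z} b := by
  classical
  have hex : ∃ t, ¬ Col G {z ∈ S | f z ≤ t} a := by
    obtain ⟨M, hM⟩ := (Set.finite_range f).bddAbove
    exact ⟨M, fun hc => h (hc.mono (fun z hz => ⟨hz, hM ⟨z, rfl⟩⟩) (by omega))⟩
  refine ⟨Nat.find hex, Nat.find_spec hex, fun hb => h ?_⟩
  have hlow : Col G {z ∈ S | f z < Nat.find hex} a := by
    by_cases h0 : Nat.find hex = 0
    · exact Col.of_empty (fun x hx => by have := hx.2; omega) a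
    · have := Nat.find_min hex (m := Nat.find hex - 1) (by omega)
      rw [not_not] at this
      exact this.mono (fun z hz => ⟨hz.1, by have := hz.2; omega⟩) le_rfl
  refine (hlow.union (hf (Nat.find hex))).of_subset_union hb fun x hx => ?_
  rcases lt_trichotomy (f x) (Nat.find hex) with h1 | h1 | h1
  · exact Or.inl (Or.inl ⟨hx, h1⟩)
  · exact Or.inl (Or.inr ⟨hx, h1⟩)
  · exact Or.inr ⟨hx, h1⟩

/-- Split `P` at a threshold with both sides large. One side of the same threshold is large in `R`;
pair it with the opposite side of `P`. -/
theorem not_col_compare [Finite V] {P R : Set V} {a b τ : ℕ} (f g : V → ℕ)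
    (hf : ∀ m, Col G {z ∈ P | f z = m} τ) (hP : ¬ Col G P (a + τ + a))
    (hR : ¬ Col G R (b + b)) :
    ∃ P' ⊆ P, ∃ R' ⊆ R, ¬ Col G P' a ∧ ¬ Col G R' b ∧
      ((∀ z ∈ P', ∀ z' ∈ R', f z < g z') ∨ (∀ z ∈ P', ∀ z' ∈ R', g z' < f z)) := by
  obtain ⟨t, h1, h2⟩ := not_col_split f hf hP
  rcases not_col_or hR (fun z => g z ≤ t) with h3 | h3
  · exact ⟨_, Set.sep_subset _ _, _, Set.sep_subset _ _, h2, h3, Or.inr fun z hz z' hz' =>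
      lt_of_le_of_lt hz'.2 hz.2⟩
  · exact ⟨_, Set.sep_subset _ _, _, Set.sep_subset _ _, h1, h3, Or.inl fun z hz z' hz' =>
      lt_of_le_of_lt hz.2 (not_le.1 hz'.2)⟩

/-! ### Distances -/

/-- `u` and `v` are at distance at most `r`. -/
def Near (G : SimpleGraph V) (r : ℕ) (u v : V) : Prop := G.edist u v ≤ (r : ℕ∞)

theorem Near.refl (r : ℕ) (u : V) : Near G r u u := by simp [Near]

theorem Near.symm {r : ℕ} {u v : V} (h : Near G r u v) : Near G r v u := by
  rw [Near, edist_comm]; exact h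

theorem Near.trans {r s : ℕ} {u v w : V} (h : Near G r u v) (h' : Near G s v w) :
    Near G (r + s) u w := by
  rw [Near] at *
  push_cast
  exact (SimpleGraph.edist_triangle (G := G)).trans (add_le_add h h')

theorem Near.mono {r s : ℕ} {u v : V} (h : Near G r u v) (hrs : r ≤ s) : Near G s u v :=
  le_trans h (by exact_mod_cast hrs)

theorem Near.trans_le {r s t : ℕ} {u v w : V} (h : Near G r u v) (h' : Near G s v w)
    (ht : r + s ≤ t) : Near G t u w := (h.trans h').mono ht

theorem near_of_adj {u v : V} (h : G.Adj u v) : Near G 1 u v := by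
  rw [Near, Nat.cast_one, edist_le_one_iff_adj_or_eq]; exact Or.inl h

theorem near_chain (p : ℕ → V) {a b : ℕ} (hab : a ≤ b)
    (h : ∀ k, a ≤ k → k < b → G.Adj (p k) (p (k + 1))) : Near G (b - a) (p a) (p b) := by
  induction b, hab using Nat.le_induction with
  | base => exact Near.refl _ _
  | succ b hb ih =>
    exact (ih fun k hk hk' => h k hk (by omega)).trans_le (near_of_adj (h b hb (by omega)))
      (by omega)

theorem ne_of_not_near {r : ℕ} {u v : V} (h : ¬ Near G r u v) : u ≠ v := by
  rintro rfl; exact h (Near.refl _ _)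

/-- Every ball of radius `r` can be coloured with `τ` colours. -/
def BallsCol (G : SimpleGraph V) (r τ : ℕ) : Prop := ∀ v, Col G {u | Near G r v u} τ

/-- Avoiding the ball of one vertex of `A` costs `τ` colours. This is how new pieces are kept away
from finitely many old vertices. -/
theorem BallsCol.not_col_far {r τ k : ℕ} (hB : BallsCol G r τ) (A : List V) {N : Set V}
    (h : ¬ Col G N (k + A.length * τ)) :
    ¬ Col G {z ∈ N | ∀ w ∈ A, ¬ Near G r w z} k := by
  induction A generalizing N with
  | nil => intro hc; exact h (hc.mono (fun z hz => ⟨hz, by simp⟩) (by simp))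
  | cons w A ih =>
    intro hc
    have h1 : ¬ Col G {z ∈ N | ¬ Near G r w z} (k + A.length * τ) := by
      intro h2
      refine h ((h2.of_subset_union (hB w) fun x hx => ?_).mono le_rfl (by
        rw [List.length_cons, Nat.succ_mul]; omega))
      by_cases hx' : Near G r w x
      · exact Or.inr hx'
      · exact Or.inl ⟨hx, hx'⟩
    refine ih h1 (hc.mono ?_ le_rfl)
    rintro z ⟨⟨h3, h4⟩, h5⟩
    refine ⟨h3, fun y hy => ?_⟩
    rcases List.mem_cons.1 hy with rfl | hy
    · exact h4
    · exact h5 y hy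

/-! ### Induced paths -/

/-- `l` lists the vertices of an induced path from the first vertex to the second. -/
inductive IndPath (G : SimpleGraph V) : V → V → List V → Prop
  | single (a : V) : IndPath G a a [a]
  | cons {a b c : V} {l : List V} : G.Adj a b → IndPath G b c l →
      (∀ x ∈ l, G.Adj a x → x = b) → a ∉ l → IndPath G a c (a :: l)

namespace IndPath

theorem length_pos {a b : V} {l : List V} (h : IndPath G a b l) : 1 ≤ l.length := by
  cases h <;> simp

theorem left_mem {a b : V} {l : List V} (h : IndPath G a b l) : a ∈ l := by
  cases h <;> simp

theorem right_mem {a b : V} {l : List V} (h : IndPath G a b l) : b ∈ l := by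
  induction h with
  | single => simp
  | cons _ _ _ _ ih => simp [ih]

theorem join {a b c d : V} {l₁ l₂ : List V} (h₁ : IndPath G a b l₁) (h₂ : IndPath G c d l₂)
    (hbc : G.Adj b c) (h : ∀ x ∈ l₁, ∀ y ∈ l₂, x ≠ y ∧ (G.Adj x y → x = b ∧ y = c)) :
    IndPath G a d (l₁ ++ l₂) := by
  induction h₁ with
  | single a =>
    exact cons hbc h₂ (fun x hx hax => ((h a (by simp) x hx).2 hax).2)
      (fun ha => (h a (by simp) a ha).1 rfl)
  | @cons a b' b l hab hl h3 h4 ih =>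
    refine cons hab (ih hbc fun x hx => h x (by simp [hx])) ?_ ?_
    · intro x hx hax
      rcases List.mem_append.1 hx with hx | hx
      · exact h3 x hx hax
      · have := ((h a (by simp) x hx).2 hax).1
        subst this
        exact (h4 hl.right_mem).elim
    · intro ha
      rcases List.mem_append.1 ha with ha | ha
      · exact h4 ha
      · exact (h a (by simp) a ha).1 rfl

theorem trans {a b c : V} {l₁ l₂ : List V} (h₁ : IndPath G a b l₁)
    (h₂ : IndPath G b c (b :: l₂))
    (h : ∀ x ∈ l₁, ∀ y ∈ l₂, x ≠ y ∧ (G.Adj x y → x = b)) :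
    IndPath G a c (l₁ ++ l₂) := by
  cases h₂ with
  | single => simpa using h₁
  | cons hbb' hl h3 h4 =>
    refine h₁.join hl hbb' fun x hx y hy => ⟨(h x hx y hy).1, fun hxy => ?_⟩
    have := (h x hx y hy).2 hxy
    subst this
    exact ⟨rfl, h3 y hy hxy⟩

theorem eq_cons {a b : V} {l : List V} (h : IndPath G a b l) :
    ∃ l', l = a :: l' ∧ a ∉ l' := by
  cases h with
  | single => exact ⟨[], rfl, by simp⟩
  | cons _ _ _ h4 => exact ⟨_, rfl, h4⟩

theorem eq_append {a b : V} {l : List V} (h : IndPath G a b l) :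
    ∃ l', l = l' ++ [b] ∧ b ∉ l' := by
  induction h with
  | single a => exact ⟨[], rfl, by simp⟩
  | @cons a b' b l hab hl h3 h4 ih =>
    obtain ⟨l', rfl, hb⟩ := ih
    refine ⟨a :: l', rfl, ?_⟩
    simp only [List.mem_cons, not_or]
    refine ⟨?_, hb⟩
    rintro rfl
    exact h4 (by simp)

theorem eq_cons_append {a b : V} {l : List V} (h : IndPath G a b l) (hab : a ≠ b) :
    ∃ m, l = a :: (m ++ [b]) ∧ a ∉ m ∧ b ∉ m := by
  obtain ⟨l', rfl, h1⟩ := h.eq_cons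
  obtain ⟨l'', h2, h3⟩ := h.eq_append
  cases l'' with
  | nil => simp at h2; exact (hab h2.1).elim
  | cons x m =>
    simp only [List.cons_append, List.cons.injEq] at h2
    obtain ⟨rfl, rfl⟩ := h2
    exact ⟨m, rfl, fun h => h1 (by simp [h]), fun h => h3 (by simp [h])⟩

theorem near_ends {a b : V} {l : List V} (h : IndPath G a b l) :
    Near G (l.length - 1) a b := by
  induction h with
  | single a => exact Near.refl _ _
  | cons hab hl _ _ ih =>
    have := hl.length_pos
    exact (near_of_adj hab).trans_le ih (by simp only [List.length_cons]; omega)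

theorem near_split {a b y : V} {l : List V} (h : IndPath G a b l) (hy : y ∈ l) :
    ∃ s t, s + t + 1 = l.length ∧ Near G s a y ∧ Near G t y b := by
  induction h with
  | single a =>
    rw [List.mem_singleton] at hy; subst hy
    exact ⟨0, 0, rfl, Near.refl _ _, Near.refl _ _⟩
  | @cons a b' b l hab hl h3 h4 ih =>
    rcases List.mem_cons.1 hy with rfl | hy
    · have := hl.length_pos
      refine ⟨0, l.length, by simp, Near.refl _ _, ?_⟩
      exact (near_of_adj hab).trans_le hl.near_ends (by omega)
    · obtain ⟨s, t, hst, hs, ht⟩ := ih hy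
      refine ⟨s + 1, t, by simp only [List.length_cons]; omega, ?_, ht⟩
      exact (near_of_adj hab).trans_le hs (by omega)

theorem exists_crossing {a b : V} {l : List V} (h : IndPath G a b l) (P : V → Prop)
    (ha : P a) (hb : ¬ P b) : ∃ y ∈ l, ∃ y' ∈ l, G.Adj y y' ∧ P y ∧ ¬ P y' := by
  induction h with
  | single a => exact (hb ha).elim
  | @cons a b' b l hab hl h3 h4 ih =>
    by_cases hP : P b'
    · obtain ⟨y, hy, y', hy', h5⟩ := ih hP hb
      exact ⟨y, by simp [hy], y', by simp [hy'], h5⟩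
    · exact ⟨a, by simp, b', by simp [hl.left_mem], hab, ha, hP⟩

theorem getElem_zero {a b : V} {l : List V} (h : IndPath G a b l) :
    l[0]'h.length_pos = a := by
  cases h <;> rfl

theorem nodup {a b : V} {l : List V} (h : IndPath G a b l) : l.Nodup := by
  induction h with
  | single a => simp
  | cons _ _ _ h4 ih => exact List.nodup_cons.2 ⟨h4, ih⟩

theorem adj_getElem_iff {a b : V} {l : List V} (h : IndPath G a b l) :
    ∀ i j (hi : i < l.length) (hj : j < l.length), i < j → (G.Adj l[i] l[j] ↔ j = i + 1) := by
  induction h with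
  | single a => intro i j hi hj hij; simp at hi hj; omega
  | @cons a b' b l hab hl h3 h4 ih =>
    intro i j hi hj hij
    obtain ⟨j, rfl⟩ : ∃ j', j = j' + 1 := ⟨j - 1, by omega⟩
    have hj' : j < l.length := by simpa using hj
    rcases i with _ | i
    · simp only [List.getElem_cons_zero, List.getElem_cons_succ]
      constructor
      · intro hadj
        have h5 := h3 _ (List.getElem_mem hj') hadj
        rw [← hl.getElem_zero] at h5
        have := (hl.nodup.getElem_inj_iff).1 h5
        omega
      · intro h5
        have : j = 0 := by omega
        subst this
        rw [hl.getElem_zero]; exact hab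
    · simp only [List.getElem_cons_succ]
      rw [ih i j (by simpa using hi) hj' (by omega)]
      omega

theorem getElem_last {a b : V} {l : List V} (h : IndPath G a b l) :
    l[l.length - 1]'(by have := h.length_pos; omega) = b := by
  obtain ⟨l', rfl, -⟩ := h.eq_append
  simp

/-- An induced path together with a vertex adjacent exactly to its two ends is a hole. -/
theorem isHole {a b v : V} {l : List V} (h : IndPath G a b l) (hlen : 3 ≤ l.length)
    (hv : v ∉ l) (hadj : ∀ y ∈ l, (G.Adj v y ↔ y = a ∨ y = b)) :
    G.IsHole (l.length + 1) {x | x = v ∨ x ∈ l} := by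
  refine ⟨by omega, ?_⟩
  have hnd : (v :: l).Nodup := List.nodup_cons.2 ⟨hv, h.nodup⟩
  have key : ∀ i j (hi : i < (v :: l).length) (hj : j < (v :: l).length), i < j →
      (G.Adj (v :: l)[i] (v :: l)[j] ↔ j = i + 1 ∨ (i = 0 ∧ j = l.length)) := by
    intro i j hi hj hij
    obtain ⟨j, rfl⟩ : ∃ j', j = j' + 1 := ⟨j - 1, by omega⟩
    have hj' : j < l.length := by simpa using hj
    rcases i with _ | i
    · simp only [List.getElem_cons_zero, List.getElem_cons_succ]
      rw [hadj _ (List.getElem_mem hj')]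
      have h1 : l[j] = l[0]'(by omega) ↔ j = 0 := h.nodup.getElem_inj_iff
      have h2 : l[j] = l[l.length - 1]'(by omega) ↔ j = l.length - 1 := h.nodup.getElem_inj_iff
      rw [h.getElem_zero] at h1
      rw [h.getElem_last] at h2
      rw [h1, h2]
      have h5 : j = l.length - 1 ↔ j + 1 = l.length := by omega
      simp [h5]
    · simp only [List.getElem_cons_succ]
      rw [h.adj_getElem_iff i j (by simpa using hi) hj' (by omega)]
      omega
  have hlt : ∀ i : Fin (l.length + 1), (i : ℕ) < (v :: l).length := fun i => i.2
  let f : Fin (l.length + 1) → {x | x = v ∨ x ∈ l} := fun i =>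
    ⟨(v :: l)[(i : ℕ)]'(hlt i), by
      have := List.getElem_mem (l := v :: l) (n := (i : ℕ)) (hlt i)
      exact List.mem_cons.1 this⟩
  have hf : Function.Bijective f := by
    constructor
    · intro i j hij
      have : (v :: l)[(i : ℕ)]'(hlt i) = (v :: l)[(j : ℕ)]'(hlt j) := congrArg Subtype.val hij
      exact Fin.ext ((hnd.getElem_inj_iff).1 this)
    · rintro ⟨x, hx⟩
      obtain ⟨i, hi, rfl⟩ := List.mem_iff_getElem.1 (List.mem_cons.2 hx)
      exact ⟨⟨i, by simpa using hi⟩, rfl⟩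
  refine ⟨⟨Equiv.ofBijective f hf, ?_⟩⟩
  have hadj' : ∀ i j : Fin (l.length + 1), i < j →
      (G.Adj (f i : V) (f j) ↔ (cycleGraph (l.length + 1)).Adj i j) := by
    intro i j hij
    have hi := i.2
    have hj := j.2
    rw [Fin.lt_def] at hij
    have h5 := key i j (hlt i) (hlt j) hij
    rw [cycleGraph_adj', Fin.sub_val_of_le (Fin.le_def.2 hij.le), Fin.val_sub]
    have h6 : (l.length + 1 - (j : ℕ) + i) % (l.length + 1) = l.length + 1 - (j : ℕ) + i :=
      Nat.mod_eq_of_lt (by omega)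
    rw [h6]
    refine h5.trans ?_
    omega
  intro i j
  simp only [Equiv.ofBijective_apply, comap_adj, Function.Embedding.subtype_apply]
  rcases lt_trichotomy i j with hij | hij | hij
  · exact hadj' i j hij
  · subst hij; simp
  · rw [G.adj_comm, (cycleGraph _).adj_comm]; exact hadj' j i hij

/-- Join `a` to the last vertex of the path that equals it or is adjacent to it, and drop everything
before. Iterated along a walk, this extracts an induced path that is no longer. -/
theorem exists_prepend {a b c : V} {l : List V} (h : IndPath G b c l)
    (ha : ∃ x ∈ l, x = a ∨ G.Adj a x) :
    ∃ l', IndPath G a c l' ∧ l'.length ≤ l.length + 1 ∧ ∀ y ∈ l', y = a ∨ y ∈ l := by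
  induction h with
  | single b =>
    obtain ⟨x, hx, hx'⟩ := ha
    rw [List.mem_singleton] at hx; subst hx
    rcases hx' with rfl | hx'
    · exact ⟨[x], single x, by simp, by simp⟩
    · exact ⟨[a, x], cons hx' (single x) (by simp) (by simpa using hx'.ne), by simp, by simp⟩
  | @cons b b' c l hab hl h3 h4 ih =>
    by_cases hx : ∃ x ∈ l, x = a ∨ G.Adj a x
    · obtain ⟨l', h5, h6, h7⟩ := ih hx
      refine ⟨l', h5, by simp only [List.length_cons]; omega, fun y hy => ?_⟩
      rcases h7 y hy with h8 | h8
      · exact Or.inl h8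
      · exact Or.inr (by simp [h8])
    · push Not at hx
      obtain ⟨x, hx', hx''⟩ := ha
      have : x = b := by
        rcases List.mem_cons.1 hx' with h5 | h5
        · exact h5
        · rcases hx'' with h6 | h6
          · exact ((hx x h5).1 h6).elim
          · exact ((hx x h5).2 h6).elim
      subst this
      rcases hx'' with rfl | hx''
      · exact ⟨x :: l, cons hab hl h3 h4, by simp, by simp⟩
      · refine ⟨a :: x :: l, cons hx'' (cons hab hl h3 h4) ?_ ?_, by simp, by simp⟩
        · intro y hy hay
          rcases List.mem_cons.1 hy with h5 | h5
          · exact h5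
          · exact ((hx y h5).2 hay).elim
        · intro h5
          rcases List.mem_cons.1 h5 with h6 | h6
          · exact hx''.ne h6
          · exact (hx a h6).1 rfl

end IndPath

/-! ### Walks inside a set -/

/-- There is a walk with `n` edges between two vertices inside the set `Q`. -/
inductive Conn (G : SimpleGraph V) (Q : Set V) : ℕ → V → V → Prop
  | refl {a : V} : a ∈ Q → Conn G Q 0 a a
  | step {a b c : V} {n : ℕ} : a ∈ Q → G.Adj a b → Conn G Q n b c → Conn G Q (n + 1) a c

namespace Conn

variable {Q : Set V}

theorem trans {m n : ℕ} {a b c : V} (h : Conn G Q m a b) (h' : Conn G Q n b c) :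
    Conn G Q (m + n) a c := by
  induction h with
  | refl => simpa using h'
  | step ha hab _ ih => rw [Nat.succ_add]; exact step ha hab (ih h')

theorem snoc {n : ℕ} {a b c : V} (h : Conn G Q n a b) (hbc : G.Adj b c) (hc : c ∈ Q) :
    Conn G Q (n + 1) a c := by
  induction h with
  | refl ha => exact step ha hbc (refl hc)
  | step ha hab _ ih => exact step ha hab (ih hbc)

theorem symm {n : ℕ} {a b : V} (h : Conn G Q n a b) : Conn G Q n b a := by
  induction h with
  | refl ha => exact refl ha
  | step ha hab _ ih => exact ih.snoc hab.symm ha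

theorem of_seq (p : ℕ → V) {a b : ℕ} (hab : a ≤ b) (hQ : ∀ k, a ≤ k → k ≤ b → p k ∈ Q)
    (h : ∀ k, a ≤ k → k < b → G.Adj (p k) (p (k + 1))) : Conn G Q (b - a) (p a) (p b) := by
  induction b, hab using Nat.le_induction with
  | base => simpa using refl (hQ a le_rfl le_rfl)
  | succ b hb ih =>
    rw [Nat.succ_sub hb]
    exact (ih (fun k hk hk' => hQ k hk (by omega)) fun k hk hk' => h k hk (by omega)).snoc
      (h b hb (by omega)) (hQ _ (by omega) le_rfl)

theorem exists_indPath {n : ℕ} {a b : V} (h : Conn G Q n a b) :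
    ∃ l, IndPath G a b l ∧ l.length ≤ n + 1 ∧ ∀ y ∈ l, y ∈ Q := by
  induction h with
  | refl ha => exact ⟨_, IndPath.single _, by simp, by simpa using ha⟩
  | step ha hab _ ih =>
    obtain ⟨l, h1, h2, h3⟩ := ih
    obtain ⟨l', h4, h5, h6⟩ := h1.exists_prepend ⟨_, h1.left_mem, Or.inr hab⟩
    refine ⟨l', h4, by omega, fun y hy => ?_⟩
    rcases h6 y hy with rfl | h7
    · exact ha
    · exact h3 y h7

end Conn

end

section

variable {V : Type*} {G : SimpleGraph V}

/-! ### More on colourings -/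

theorem exists_fiber_not_col {α : Type*} {S : Set V} {k m : ℕ} (s : Finset α) (f : V → α)
    (hf : ∀ v ∈ S, f v ∈ s) (hm : s.card * k ≤ m) (h : ¬ Col G S m) :
    ∃ a ∈ s, ¬ Col G {v ∈ S | f v = a} k := by
  have h' : ¬ Col G S (s.card * k) := fun hc => h (hc.mono subset_rfl hm)
  obtain ⟨i, hi, hc⟩ := exists_class_not_col h'
    (fun i v => ∃ hi : i < s.card, (s.equivFin.symm ⟨i, hi⟩ : α) = f v) (by
      intro v hv
      refine ⟨s.equivFin ⟨f v, hf v hv⟩, Fin.is_lt _, Fin.is_lt _, ?_⟩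
      simp)
  refine ⟨s.equivFin.symm ⟨i, hi⟩, Subtype.coe_prop _, fun h1 => hc (h1.mono ?_ le_rfl)⟩
  rintro v ⟨hv, _, h2⟩
  exact ⟨hv, h2.symm⟩

theorem Col.card_clique_le {S : Set V} {k : ℕ} (h : Col G S k) {K : Finset V}
    (hK : G.IsClique (K : Set V)) (hS : ∀ x ∈ K, x ∈ S) : K.card ≤ k := by
  obtain ⟨c, hc, hc'⟩ := h
  have := Finset.card_le_card_of_injOn (s := K) (t := Finset.range k) c
    (fun x hx => by simpa using hc x (hS x hx)) (by
      intro x hx y hy hxy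
      by_contra hne
      exact hc' x (hS x hx) y (hS y hy) (hK hx hy hne) hxy)
  simpa using this

theorem exists_first (r : V → ℕ) {P : V → Prop} (h : ∃ b, P b) :
    ∃ b, P b ∧ ∀ b', P b' → r b ≤ r b' := by
  obtain ⟨b, hb, hb'⟩ := (measure r).wf.has_min {b | P b} h
  exact ⟨b, hb, fun b' h' => not_lt.1 (hb' b' h')⟩

/-- As `r` is injective, a level of `r ∘ g` fixes the vertex `g z`, and all such `z` lie in one ball
around it. This supplies the fibre hypothesis of `not_col_split`. -/
theorem BallsCol.col_rank_fiber {q τ : ℕ} (hB : BallsCol G q τ) {r : V → ℕ}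
    (hr : Function.Injective r) {S : Set V} (g : V → V) (hg : ∀ z ∈ S, Near G q (g z) z)
    (m : ℕ) : Col G {z ∈ S | r (g z) = m} τ := by
  by_cases h : ∃ w, w ∈ S ∧ r (g w) = m
  · obtain ⟨w, hw, rfl⟩ := h
    refine (hB (g w)).mono ?_ le_rfl
    rintro z ⟨hz, hz'⟩
    rw [Set.mem_ofPred_eq, ← hr hz']
    exact hg z hz
  · exact Col.of_empty (fun z hz => h ⟨z, hz⟩) τ

/-! ### Hubs -/

/-- Large vertex sets contain, inside the graph they induce, a large ball of radius `ρ`. -/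
def BallControl (G : SimpleGraph V) (ρ : ℕ) (φ : ℕ → ℕ) : Prop :=
  ∀ (S : Set V) (k : ℕ), (∀ w ∈ S, Col G {x | ∃ n ≤ ρ, Conn G S n w x} k) → Col G S (φ k)

theorem conn_of_walk {S : Set V} {a b : S} (p : (G.induce S).Walk a b) :
    Conn G S p.length a b := by
  induction p with
  | nil => exact Conn.refl (Subtype.coe_prop _)
  | cons h p ih => exact Conn.step (Subtype.coe_prop _) h ih

theorem ballControl_of_isControlled [Finite V] {ρ : ℕ} {φ : ℕ → ℕ} (hφ : Monotone φ)
    (h : G.IsControlled ρ φ) : BallControl G ρ φ := by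
  intro S k hk
  rw [← chromaticNumber_induce_le_iff]
  refine (h S).trans ?_
  have h1 : (G.induce S).ballChromaticNumber ρ ≤ (k : ℕ∞) := by
    refine iSup_le fun v => ?_
    rw [chromaticNumber_induce_le_iff]
    obtain ⟨c, hc, hc'⟩ := hk v v.2
    have hmem : ∀ x ∈ (G.induce S).distBall ρ v, ∃ n ≤ ρ, Conn G S n v x := by
      intro x hx
      have hx' : (G.induce S).edist v x ≤ ρ := hx
      have hne : (G.induce S).edist v x ≠ ⊤ := ne_top_of_le_ne_top (ENat.natCast_ne_top _) hx'
      obtain ⟨p, hp⟩ := exists_walk_of_edist_ne_top hne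
      refine ⟨p.length, ?_, conn_of_walk p⟩
      rw [← hp] at hx'
      exact_mod_cast hx'
    exact ⟨fun x => c x, fun x hx => hc x (hmem x hx),
      fun x hx y hy hxy => hc' x (hmem x hx) y (hmem y hy) hxy⟩
  have h2 : ((G.induce S).ballChromaticNumber ρ).toNat ≤ k := ENat.toNat_le_of_le_natCast h1
  exact_mod_cast hφ h2

theorem Conn.exists_seq {Q : Set V} {n : ℕ} {a b : V} (h : Conn G Q n a b) :
    ∃ p : ℕ → V, p 0 = a ∧ p n = b ∧ (∀ k < n, G.Adj (p k) (p (k + 1))) ∧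
      ∀ k ≤ n, p k ∈ Q := by
  induction h with
  | @refl a ha => exact ⟨fun _ => a, rfl, rfl, by simp, fun _ _ => ha⟩
  | @step a b c n ha hab _ ih =>
    obtain ⟨p, h0, hn, hadj, hQ⟩ := ih
    refine ⟨fun k => Nat.casesOn k a p, rfl, hn, ?_, ?_⟩
    · rintro (_ | k) hk
      · simpa [h0] using hab
      · exact hadj k (by omega)
    · rintro (_ | k) hk
      · exact ha
      · exact hQ k (by omega)

theorem Conn.near {Q : Set V} {n : ℕ} {a b : V} (h : Conn G Q n a b) : Near G n a b := by
  induction h with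
  | refl => exact Near.refl _ _
  | step _ hab _ ih => exact (near_of_adj hab).trans_le ih (by omega)

/-- Every vertex `z` of `Z` is at distance `ρ` from `w`, and is joined to `w` inside `S` by the
path `u z 0, …, u z ρ` whose second vertex is the first possible one of the stable set `B`. -/
structure IsHub (G : SimpleGraph V) (ρ : ℕ) (r : V → ℕ) (S : Set V) (w : V) (B Z : Set V)
    (u : V → ℕ → V) : Prop where
  B_sub : B ⊆ S
  B_adj : ∀ b ∈ B, G.Adj w b
  B_stable : ∀ b ∈ B, ∀ b' ∈ B, ¬ G.Adj b b'
  Z_sub : Z ⊆ S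
  far : ∀ z ∈ Z, ¬ Near G (ρ - 1) w z
  leg_zero : ∀ z ∈ Z, u z 0 = w
  leg_one : ∀ z ∈ Z, u z 1 ∈ B
  leg_last : ∀ z ∈ Z, u z ρ = z
  leg_adj : ∀ z ∈ Z, ∀ k < ρ, G.Adj (u z k) (u z (k + 1))
  leg_mem : ∀ z ∈ Z, ∀ k ≤ ρ, u z k ∈ S
  first : ∀ z ∈ Z, ∀ b ∈ B, G.Adj b (u z 2) → r (u z 1) ≤ r b

/-- The vertex `w` is a hub of `S` with a set of `κ`-large chromatic number. -/
def HubAt (G : SimpleGraph V) (ρ : ℕ) (r : V → ℕ) (S : Set V) (w : V) (κ : ℕ) : Prop :=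
  ∃ B Z u, IsHub G ρ r S w B Z u ∧ ¬ Col G Z κ

theorem HubAt.mono {ρ κ : ℕ} {r : V → ℕ} {S T : Set V} {w : V} (h : HubAt G ρ r S w κ)
    (hST : S ⊆ T) : HubAt G ρ r T w κ := by
  obtain ⟨B, Z, u, hH, hZ⟩ := h
  exact ⟨B, Z, u, { hH with
    B_sub := hH.B_sub.trans hST
    Z_sub := hH.Z_sub.trans hST
    leg_mem := fun z hz k hk => hST (hH.leg_mem z hz k hk) }, hZ⟩

/-- Remove from a large `ρ`-ball the part within distance `ρ - 1` of its centre, at a cost of `τ`.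
Then sort the rest by the colour of the second vertex of a path to the centre: the factor `τ` pays
for making `B` stable. -/
theorem exists_hubAt {ρ τ κ : ℕ} {φ : ℕ → ℕ} {r : V → ℕ} (hρ : 3 ≤ ρ)
    (hB : BallsCol G (ρ - 1) τ) (hC : BallControl G ρ φ) {S : Set V}
    (h : ¬ Col G S (φ (τ + τ * κ))) : ∃ w ∈ S, HubAt G ρ r S w κ := by
  have h1 : ∃ w ∈ S, ¬ Col G {x | ∃ n ≤ ρ, Conn G S n w x} (τ + τ * κ) := by
    by_contra hn
    push Not at hn
    exact h (hC S _ hn)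
  obtain ⟨w, hw, h2⟩ := h1
  refine ⟨w, hw, ?_⟩
  set N : Set V := {x | (∃ n ≤ ρ, Conn G S n w x) ∧ ¬ Near G (ρ - 1) w x}
  have h3 : ¬ Col G N (τ * κ) := by
    intro hc
    refine h2 ((hB w).of_subset_union hc fun x hx => ?_)
    by_cases hx' : Near G (ρ - 1) w x
    · exact Or.inl hx'
    · exact Or.inr ⟨hx, hx'⟩
  have h4 : ∀ z : V, ∃ p : ℕ → V, z ∈ N → p 0 = w ∧ p ρ = z ∧
      (∀ k < ρ, G.Adj (p k) (p (k + 1))) ∧ ∀ k ≤ ρ, p k ∈ S := by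
    intro z
    by_cases hz : z ∈ N
    · obtain ⟨⟨n, hn, hc⟩, hf⟩ := hz
      have : n = ρ := by
        by_contra hne
        exact hf (hc.near.mono (by omega))
      subst this
      obtain ⟨p, hp⟩ := hc.exists_seq
      exact ⟨p, fun _ => hp⟩
    · exact ⟨fun _ => z, fun hz' => (hz hz').elim⟩
  choose p hp using h4
  obtain ⟨c, hc, hc'⟩ := hB w
  have hnear : ∀ {b : V}, G.Adj w b → b ∈ {u | Near G (ρ - 1) w u} := fun hb =>
    (near_of_adj hb).mono (by omega)
  have hp1 : ∀ z ∈ N, G.Adj w (p z 1) := by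
    intro z hz
    have := (hp z hz).2.2.1 0 (by omega)
    rwa [(hp z hz).1] at this
  obtain ⟨i, -, hi⟩ := exists_class_not_col h3 (fun i z => c (p z 1) = i)
    (fun z hz => ⟨_, hc _ (hnear (hp1 z hz)), rfl⟩)
  set B : Set V := {b ∈ S | G.Adj w b ∧ c b = i}
  set Z : Set V := {z ∈ N | c (p z 1) = i}
  have h5 : ∀ z : V, ∃ b, z ∈ Z → b ∈ B ∧ G.Adj b (p z 2) ∧
      ∀ b' ∈ B, G.Adj b' (p z 2) → r b ≤ r b' := by
    intro z
    by_cases hz : z ∈ Z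
    · obtain ⟨b, hb, hb'⟩ := exists_first r (P := fun b => b ∈ B ∧ G.Adj b (p z 2))
        ⟨p z 1, ⟨(hp z hz.1).2.2.2 1 (by omega), hp1 z hz.1, hz.2⟩,
          (hp z hz.1).2.2.1 1 (by omega)⟩
      exact ⟨b, fun _ => ⟨hb.1, hb.2, fun b' h1 h2 => hb' b' ⟨h1, h2⟩⟩⟩
    · exact ⟨z, fun h => (hz h).elim⟩
  choose b hb using h5
  -- Replacing the second vertex by the first vertex of `B` adjacent to the third keeps the path, as
  -- all of `B` is adjacent to `w`.
  refine ⟨B, Z, fun z k => if k = 1 then b z else p z k, ?_, hi⟩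
  have hBadj : ∀ b ∈ B, G.Adj w b := fun b hb => hb.2.1
  refine ⟨fun b hb => hb.1, hBadj, ?_, ?_, fun z hz => hz.1.2, ?_, ?_, ?_, ?_, ?_, ?_⟩
  · intro b hb b' hb' hadj
    exact hc' b (hnear hb.2.1) b' (hnear hb'.2.1) hadj (hb.2.2.trans hb'.2.2.symm)
  · intro z hz
    have := (hp z hz.1).2.2.2 ρ le_rfl
    rwa [(hp z hz.1).2.1] at this
  · intro z hz; simpa using (hp z hz.1).1
  · intro z hz; simpa using (hb z hz).1
  · intro z hz
    rw [if_neg (by omega)]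
    exact (hp z hz.1).2.1
  · intro z hz k hk
    have h6 := (hp z hz.1).2.2.1 k hk
    rcases k with _ | _ | k
    · simpa [(hp z hz.1).1] using hBadj _ (hb z hz).1
    · simpa using (hb z hz).2.1
    · simpa using h6
  · intro z hz k hk
    by_cases h1 : k = 1
    · simpa [h1] using (hb z hz).1.1
    · simpa [h1] using (hp z hz.1).2.2.2 k hk
  · intro z hz b' hb' hadj
    simpa using (hb z hz).2.2 b' hb' (by simpa using hadj)

/-- If the non-hubs of `X` needed more colours, they would contain a hub of their own, which is also
a hub of `X`. -/
theorem col_not_hubAt {ρ τ κ : ℕ} {φ : ℕ → ℕ} {r : V → ℕ} (hρ : 3 ≤ ρ)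
    (hB : BallsCol G (ρ - 1) τ) (hC : BallControl G ρ φ) (X : Set V) :
    Col G {h ∈ X | ¬ HubAt G ρ r X h κ} (φ (τ + τ * κ)) := by
  by_contra hn
  obtain ⟨w, hw, h⟩ := exists_hubAt (r := r) hρ hB hC hn
  exact hw.2 (h.mono (Set.sep_subset _ _))

/-! ### Frames -/

/-- Nested sets `D 0 ⊇ D 1 ⊇ ⋯ ⊇ D n`, where `v j` is a hub of `D j` for the set `D (j + 1)`;
only the legs to the vertices of `D n` are kept. -/
structure Frame (G : SimpleGraph V) (ρ : ℕ) (r : V → ℕ) (n : ℕ) where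
  D : ℕ → Set V
  B : ℕ → Set V
  v : ℕ → V
  x : ℕ → V → ℕ → V
  v_mem : ∀ j < n, v j ∈ D j
  D_sub : ∀ j < n, D (j + 1) ⊆ D j
  far : ∀ j < n, ∀ u ∈ D (j + 1), ¬ Near G (ρ - 1) (v j) u
  B_sub : ∀ j < n, B j ⊆ D j
  B_adj : ∀ j < n, ∀ b ∈ B j, G.Adj (v j) b
  B_stable : ∀ j < n, ∀ b ∈ B j, ∀ b' ∈ B j, ¬ G.Adj b b'
  leg_zero : ∀ j < n, ∀ z ∈ D n, x j z 0 = v j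
  leg_one : ∀ j < n, ∀ z ∈ D n, x j z 1 ∈ B j
  leg_last : ∀ j < n, ∀ z ∈ D n, x j z ρ = z
  leg_adj : ∀ j < n, ∀ z ∈ D n, ∀ k < ρ, G.Adj (x j z k) (x j z (k + 1))
  leg_mem : ∀ j < n, ∀ z ∈ D n, ∀ k ≤ ρ, x j z k ∈ D j
  first : ∀ j < n, ∀ z ∈ D n, ∀ b ∈ B j, G.Adj b (x j z 2) → r (x j z 1) ≤ r b

namespace Frame

variable {ρ n : ℕ} {r : V → ℕ}

theorem D_mono (F : Frame G ρ r n) {i j : ℕ} (hij : i ≤ j) (hj : j ≤ n) : F.D j ⊆ F.D i := by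
  induction j, hij using Nat.le_induction with
  | base => exact subset_rfl
  | succ j hj' ih => exact (F.D_sub j (by omega)).trans (ih (by omega))

theorem not_near (F : Frame G ρ r n) {j k : ℕ} (hjk : j < k) (hk : k ≤ n) {u : V}
    (hu : u ∈ F.D k) : ¬ Near G (ρ - 1) (F.v j) u :=
  F.far j (by omega) u (F.D_mono hjk hk hu)

theorem not_near_hub (F : Frame G ρ r n) {j k : ℕ} (hjk : j < k) (hk : k < n) :
    ¬ Near G (ρ - 1) (F.v j) (F.v k) := F.not_near hjk hk.le (F.v_mem k hk)

theorem leg_near (F : Frame G ρ r n) {j k m : ℕ} (hj : j < n) {z : V} (hz : z ∈ F.D n)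
    (hkm : k ≤ m) (hm : m ≤ ρ) : Near G (m - k) (F.x j z k) (F.x j z m) :=
  near_chain _ hkm fun a _ ha' => F.leg_adj j hj z hz a (by omega)

theorem leg_near_last (F : Frame G ρ r n) {j k : ℕ} (hj : j < n) {z : V} (hz : z ∈ F.D n)
    (hk : k ≤ ρ) : Near G (ρ - k) (F.x j z k) z := by
  have := F.leg_near hj hz hk le_rfl
  rwa [F.leg_last j hj z hz] at this

theorem leg_near_hub (F : Frame G ρ r n) {j k : ℕ} (hj : j < n) {z : V} (hz : z ∈ F.D n)
    (hk : k ≤ ρ) : Near G k (F.v j) (F.x j z k) := by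
  have := F.leg_near hj hz (Nat.zero_le k) hk
  rwa [F.leg_zero j hj z hz] at this

end Frame

/-- How large a set must be to contain a frame with `n` hubs whose last set is `κ`-large. -/
def frameBound (φ : ℕ → ℕ) (τ κ : ℕ) : ℕ → ℕ
  | 0 => κ
  | n + 1 => φ (τ + τ * frameBound φ τ κ n)

theorem exists_frame {ρ τ : ℕ} {φ : ℕ → ℕ} (r : V → ℕ) (hρ : 3 ≤ ρ)
    (hB : BallsCol G (ρ - 1) τ) (hC : BallControl G ρ φ) (κ n : ℕ) {S : Set V}
    (h : ¬ Col G S (frameBound φ τ κ n)) :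
    ∃ F : Frame G ρ r n, F.D 0 = S ∧ ¬ Col G (F.D n) κ := by
  induction n generalizing S with
  | zero =>
    obtain ⟨w, -⟩ := nonempty_of_not_col h
    refine ⟨⟨fun _ => S, fun _ => S, fun _ => w, fun _ _ _ => w, ?_, ?_, ?_, ?_, ?_, ?_, ?_, ?_,
      ?_, ?_, ?_, ?_⟩, rfl, h⟩
    all_goals intro j hj; omega
  | succ n ih =>
    obtain ⟨w, hw, B, Z, u, hH, hZ⟩ := exists_hubAt (r := r) hρ hB hC h
    obtain ⟨F, hF, hF'⟩ := ih hZ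
    have hsub : F.D n ⊆ Z := hF ▸ F.D_mono (Nat.zero_le n) le_rfl
    refine ⟨⟨fun j => Nat.casesOn j S F.D, fun j => Nat.casesOn j B F.B,
      fun j => Nat.casesOn j w F.v, fun j => Nat.casesOn j u F.x,
      ?_, ?_, ?_, ?_, ?_, ?_, ?_, ?_, ?_, ?_, ?_, ?_⟩, rfl, hF'⟩
    all_goals rintro (_ | j) hj
    · exact hw
    · exact F.v_mem j (by omega)
    · exact (hF ▸ hH.Z_sub : F.D 0 ⊆ S)
    · exact F.D_sub j (by omega)
    · exact fun z hz => hH.far z (hF ▸ hz)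
    · exact F.far j (by omega)
    · exact hH.B_sub
    · exact F.B_sub j (by omega)
    · exact hH.B_adj
    · exact F.B_adj j (by omega)
    · exact hH.B_stable
    · exact F.B_stable j (by omega)
    · exact fun z hz => hH.leg_zero z (hsub hz)
    · exact F.leg_zero j (by omega)
    · exact fun z hz => hH.leg_one z (hsub hz)
    · exact F.leg_one j (by omega)
    · exact fun z hz => hH.leg_last z (hsub hz)
    · exact F.leg_last j (by omega)
    · exact fun z hz => hH.leg_adj z (hsub hz)
    · exact F.leg_adj j (by omega)
    · exact fun z hz => hH.leg_mem z (hsub hz)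
    · exact F.leg_mem j (by omega)
    · exact fun z hz => hH.first z (hsub hz)
    · exact F.first j (by omega)

end

section

variable {V : Type*} {G : SimpleGraph V} {ρ n : ℕ} {r : V → ℕ}

/-! ### Links between two hubs of a frame -/

/-- An induced path with `L` edges between the hubs `v i` and `v j`, whose inner vertices belong
to `X` or to the legs of vertices of `X`. -/
def LinkIn (F : Frame G ρ r n) (X : Set V) (i j L : ℕ) : Prop :=
  ∃ m : List V, IndPath G (F.v i) (F.v j) (F.v i :: (m ++ [F.v j])) ∧ m.length + 1 = L ∧
    ∀ u ∈ m, u ∈ X ∨ ∃ z ∈ X, ∃ a, 1 ≤ a ∧ a < ρ ∧ (u = F.x i z a ∨ u = F.x j z a)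

theorem LinkIn.of_indPath (F : Frame G ρ r n) {X : Set V} {i j L : ℕ} {l : List V}
    (hij : F.v i ≠ F.v j) (h : IndPath G (F.v i) (F.v j) l) (hL : l.length = L + 1)
    (hl : ∀ u ∈ l, u = F.v i ∨ u = F.v j ∨ u ∈ X ∨
      ∃ z ∈ X, ∃ a, 1 ≤ a ∧ a < ρ ∧ (u = F.x i z a ∨ u = F.x j z a)) :
    LinkIn F X i j L := by
  obtain ⟨m, rfl, h1, h2⟩ := h.eq_cons_append hij
  refine ⟨m, h, ?_, fun u hu => ?_⟩
  · simp at hL; omega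
  · rcases hl u (by simp [hu]) with rfl | rfl | h3
    · exact (h1 hu).elim
    · exact (h2 hu).elim
    · exact h3

theorem Frame.hub_ne (F : Frame G ρ r n) {i j : ℕ} (hji : j < i) (hi : i < n) :
    F.v i ≠ F.v j := (ne_of_not_near (F.not_near_hub hji hi)).symm

theorem exists_linkIn (F : Frame G ρ r n) {X : Set V} (hX : X ⊆ F.D n) {i j : ℕ} (hji : j < i)
    (hi : i < n) {z : V} (hz : z ∈ X) : ∃ L, 1 ≤ L ∧ L ≤ 2 * ρ ∧ LinkIn F X i j L := by
  have hzD := hX hz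
  set Q : Set V := {u | ∃ a ≤ ρ, u = F.x i z a ∨ u = F.x j z a}
  have h1 : Conn G Q ρ (F.v i) z := by
    have := Conn.of_seq (G := G) (Q := Q) (F.x i z) (Nat.zero_le ρ)
      (fun k _ hk => ⟨k, hk, Or.inl rfl⟩) (fun k _ hk => F.leg_adj i hi z hzD k hk)
    rwa [F.leg_zero i hi z hzD, F.leg_last i hi z hzD] at this
  have h2 : Conn G Q ρ (F.v j) z := by
    have := Conn.of_seq (G := G) (Q := Q) (F.x j z) (Nat.zero_le ρ)
      (fun k _ hk => ⟨k, hk, Or.inr rfl⟩) (fun k _ hk => F.leg_adj j (by omega) z hzD k hk)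
    rwa [F.leg_zero j (by omega) z hzD, F.leg_last j (by omega) z hzD] at this
  obtain ⟨l, hl, hlen, hlQ⟩ := (h1.trans h2.symm).exists_indPath
  have hne := F.hub_ne hji hi
  have hlen2 : 2 ≤ l.length := by
    obtain ⟨m, rfl, -, -⟩ := hl.eq_cons_append hne
    simp
  refine ⟨l.length - 1, by omega, by omega, LinkIn.of_indPath F hne hl (by omega) ?_⟩
  intro u hu
  obtain ⟨a, ha, h3⟩ := hlQ u hu
  rcases Nat.eq_zero_or_pos a with rfl | h0
  · rw [F.leg_zero i hi z hzD, F.leg_zero j (by omega) z hzD] at h3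
    tauto
  · rcases Nat.eq_or_lt_of_le ha with rfl | h4
    · rw [F.leg_last i hi z hzD, F.leg_last j (by omega) z hzD, or_self] at h3
      exact Or.inr (Or.inr (Or.inl (h3 ▸ hz)))
    · exact Or.inr (Or.inr (Or.inr ⟨z, hz, a, h0, h4, h3⟩))

theorem ne_and_not_adj_of_near {s q : ℕ} {x y w : V} (hx : Near G s x w) (hy : ¬ Near G q y w)
    (hs : s + 1 ≤ q) : x ≠ y ∧ ¬ G.Adj x y := by
  refine ⟨?_, fun hxy => hy ((near_of_adj hxy.symm).trans_le hx (by omega))⟩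
  rintro rfl
  exact hy (hx.mono (by omega))

/-! ### Tails: paths from the hubs of the frame to a hub of `X` -/

/-- A hub `h` of `X` with stable set of neighbours `B`; for `z ∈ Z`, the vertex `b z` is the first
vertex of `B` with a neighbour at position two on the leg `u z` or the leg from `v i` to `z`. -/
structure PreTail (F : Frame G ρ r n) (X : Set V) (i : ℕ) (h : V) (B Z : Set V)
    (u : V → ℕ → V) (b : V → V) : Prop where
  h_mem : h ∈ X
  B_sub : B ⊆ X
  B_adj : ∀ b ∈ B, G.Adj h b
  B_stable : ∀ b ∈ B, ∀ b' ∈ B, ¬ G.Adj b b'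
  Z_sub : Z ⊆ X
  far : ∀ z ∈ Z, ¬ Near G (ρ - 1) h z
  leg_last : ∀ z ∈ Z, u z ρ = z
  leg_adj : ∀ z ∈ Z, ∀ k, 2 ≤ k → k < ρ → G.Adj (u z k) (u z (k + 1))
  leg_mem : ∀ z ∈ Z, ∀ k, 2 ≤ k → k ≤ ρ → u z k ∈ X
  b_mem : ∀ z ∈ Z, b z ∈ B
  b_adj : ∀ z ∈ Z, G.Adj (b z) (u z 2) ∨ G.Adj (b z) (F.x i z 2)
  first : ∀ z ∈ Z, ∀ b' ∈ B, G.Adj b' (u z 2) ∨ G.Adj b' (F.x i z 2) → r (b z) ≤ r b'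

/-- Induced paths with `a` vertices from `v i` to `b`, and with `a'` vertices from `b` to `v j`,
along the legs of `z`. -/
def HasLengths (F : Frame G ρ r n) (i j : ℕ) (u : V → ℕ → V) (b z : V) (a a' : ℕ) : Prop :=
  (∃ l, IndPath G (F.v i) b l ∧ l.length = a ∧ ∀ y ∈ l, y = F.v i ∨ y = b ∨
    (∃ k, 2 ≤ k ∧ k ≤ ρ ∧ y = u z k) ∨ ∃ k, 1 ≤ k ∧ k < ρ ∧ y = F.x i z k) ∧
  ∃ l, IndPath G b (F.v j) l ∧ l.length = a' ∧ ∀ y ∈ l, y = F.v j ∨ y = b ∨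
    (∃ k, 2 ≤ k ∧ k ≤ ρ ∧ y = u z k) ∨ (∃ k, 2 ≤ k ∧ k < ρ ∧ y = F.x i z k) ∨
    ∃ k, 1 ≤ k ∧ k < ρ ∧ y = F.x j z k

namespace PreTail

variable {F : Frame G ρ r n} {X : Set V} {i j : ℕ} {h : V} {B Z : Set V} {u : V → ℕ → V}
  {b : V → V}

theorem mono (T : PreTail F X i h B Z u b) {Z' : Set V} (hZ : Z' ⊆ Z) :
    PreTail F X i h B Z' u b where
  h_mem := T.h_mem
  B_sub := T.B_sub
  B_adj := T.B_adj
  B_stable := T.B_stable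
  Z_sub := hZ.trans T.Z_sub
  far := fun z hz => T.far z (hZ hz)
  leg_last := fun z hz => T.leg_last z (hZ hz)
  leg_adj := fun z hz => T.leg_adj z (hZ hz)
  leg_mem := fun z hz => T.leg_mem z (hZ hz)
  b_mem := fun z hz => T.b_mem z (hZ hz)
  b_adj := fun z hz => T.b_adj z (hZ hz)
  first := fun z hz => T.first z (hZ hz)

theorem mono_B (T : PreTail F X i h B Z u b) {B' : Set V} (hB : B' ⊆ B)
    (hb : ∀ z ∈ Z, b z ∈ B') : PreTail F X i h B' Z u b where
  h_mem := T.h_mem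
  B_sub := hB.trans T.B_sub
  B_adj := fun b hb => T.B_adj b (hB hb)
  B_stable := fun b hb b' hb' => T.B_stable b (hB hb) b' (hB hb')
  Z_sub := T.Z_sub
  far := T.far
  leg_last := T.leg_last
  leg_adj := T.leg_adj
  leg_mem := T.leg_mem
  b_mem := hb
  b_adj := T.b_adj
  first := fun z hz b' hb' => T.first z hz b' (hB hb')

theorem leg_near (T : PreTail F X i h B Z u b) {z : V} (hz : z ∈ Z) {k : ℕ} (hk : 2 ≤ k)
    (hk' : k ≤ ρ) : Near G (ρ - k) (u z k) z := by
  have := near_chain (G := G) (u z) hk' fun a ha ha' => T.leg_adj z hz a (by omega) ha'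
  rwa [T.leg_last z hz] at this

theorem b_near (T : PreTail F X i h B Z u b) (hρ : 3 ≤ ρ) (hX : X ⊆ F.D n) (hi : i < n)
    {z : V} (hz : z ∈ Z) : Near G (ρ - 1) (b z) z := by
  rcases T.b_adj z hz with h1 | h1
  · exact (near_of_adj h1).trans_le (T.leg_near hz le_rfl (by omega)) (by omega)
  · exact (near_of_adj h1).trans_le
      (F.leg_near_last hi (hX (T.Z_sub hz)) (by omega : 2 ≤ ρ)) (by omega)

/-- Each walk runs along a full leg of length `ρ` between a frame hub and `z`, `ρ - 2` edges between
`z` and position two, and one edge at `b z`: `2 * ρ - 1` edges, so at most `2 * ρ` vertices. The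
second path omits position one of the leg from `v i`, because that vertex is adjacent to `v i`. -/
theorem exists_lengths (T : PreTail F X i h B Z u b) (hρ : 3 ≤ ρ) (hX : X ⊆ F.D n)
    (hji : j < i) (hi : i < n) {z : V} (hz : z ∈ Z) :
    ∃ a a', a ≤ 2 * ρ ∧ a' ≤ 2 * ρ ∧ HasLengths F i j u (b z) z a a' := by
  have hzD := hX (T.Z_sub hz)
  have hleg : ∀ {Q : Set V}, (∀ k, 2 ≤ k → k ≤ ρ → u z k ∈ Q) →
      Conn G Q (ρ - 2) (u z 2) z := by
    intro Q hQ
    have := Conn.of_seq (G := G) (Q := Q) (u z) (by omega : 2 ≤ ρ) hQ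
      (fun k hk hk' => T.leg_adj z hz k hk hk')
    rwa [T.leg_last z hz] at this
  have hold : ∃ l, IndPath G (F.v i) (b z) l ∧ l.length ≤ 2 * ρ ∧ ∀ y ∈ l, y = F.v i ∨ y = b z ∨
      (∃ k, 2 ≤ k ∧ k ≤ ρ ∧ y = u z k) ∨ ∃ k, 1 ≤ k ∧ k < ρ ∧ y = F.x i z k := by
    set Q : Set V := {y | y = F.v i ∨ y = b z ∨ (∃ k, 2 ≤ k ∧ k ≤ ρ ∧ y = u z k) ∨
      ∃ k, 1 ≤ k ∧ k < ρ ∧ y = F.x i z k}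
    have hx : ∀ k, k ≤ ρ → F.x i z k ∈ Q := by
      intro k hk
      rcases Nat.eq_zero_or_pos k with rfl | h0
      · exact Or.inl (F.leg_zero i hi z hzD)
      rcases Nat.eq_or_lt_of_le hk with rfl | h1
      · exact Or.inr (Or.inr (Or.inl ⟨k, by omega, le_rfl, by
          rw [F.leg_last i hi z hzD, T.leg_last z hz]⟩))
      · exact Or.inr (Or.inr (Or.inr ⟨k, h0, h1, rfl⟩))
    have hc : ∀ k, k ≤ ρ → Conn G Q k (F.v i) (F.x i z k) := by
      intro k hk
      have := Conn.of_seq (G := G) (Q := Q) (F.x i z) (Nat.zero_le k)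
        (fun a _ ha => hx a (by omega)) (fun a _ ha => F.leg_adj i hi z hzD a (by omega))
      rwa [F.leg_zero i hi z hzD] at this
    have hbQ : b z ∈ Q := Or.inr (Or.inl rfl)
    rcases T.b_adj z hz with h1 | h1
    · have h2 := hc ρ le_rfl
      rw [F.leg_last i hi z hzD] at h2
      have h3 : Conn G Q (ρ - 2) (u z 2) z :=
        hleg fun k hk hk' => Or.inr (Or.inr (Or.inl ⟨k, hk, hk', rfl⟩))
      obtain ⟨l, h4, h5, h6⟩ := ((h2.trans h3.symm).snoc h1.symm hbQ).exists_indPath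
      exact ⟨l, h4, by omega, h6⟩
    · obtain ⟨l, h4, h5, h6⟩ := ((hc 2 (by omega)).snoc h1.symm hbQ).exists_indPath
      exact ⟨l, h4, by omega, h6⟩
  have hnew : ∃ l, IndPath G (b z) (F.v j) l ∧ l.length ≤ 2 * ρ ∧ ∀ y ∈ l, y = F.v j ∨ y = b z ∨
      (∃ k, 2 ≤ k ∧ k ≤ ρ ∧ y = u z k) ∨ (∃ k, 2 ≤ k ∧ k < ρ ∧ y = F.x i z k) ∨
      ∃ k, 1 ≤ k ∧ k < ρ ∧ y = F.x j z k := by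
    set Q : Set V := {y | y = F.v j ∨ y = b z ∨ (∃ k, 2 ≤ k ∧ k ≤ ρ ∧ y = u z k) ∨
      (∃ k, 2 ≤ k ∧ k < ρ ∧ y = F.x i z k) ∨ ∃ k, 1 ≤ k ∧ k < ρ ∧ y = F.x j z k}
    have hj : j < n := by omega
    have hzQ : z ∈ Q := Or.inr (Or.inr (Or.inl ⟨ρ, by omega, le_rfl, (T.leg_last z hz).symm⟩))
    have hbQ : b z ∈ Q := Or.inr (Or.inl rfl)
    have h1 : Conn G Q ρ (F.v j) z := by
      have := Conn.of_seq (G := G) (Q := Q) (F.x j z) (Nat.zero_le ρ) (fun k _ hk => ?_)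
        (fun a _ ha => F.leg_adj j hj z hzD a (by omega))
      · rwa [F.leg_zero j hj z hzD, F.leg_last j hj z hzD] at this
      rcases Nat.eq_zero_or_pos k with rfl | h0
      · exact Or.inl (F.leg_zero j hj z hzD)
      rcases Nat.eq_or_lt_of_le hk with rfl | h1
      · rwa [F.leg_last j hj z hzD]
      · exact Or.inr (Or.inr (Or.inr (Or.inr ⟨k, h0, h1, rfl⟩)))
    have h2 : ∃ c, G.Adj (b z) c ∧ Conn G Q (ρ - 2) c z := by
      rcases T.b_adj z hz with h2 | h2
      · exact ⟨_, h2, hleg fun k hk hk' => Or.inr (Or.inr (Or.inl ⟨k, hk, hk', rfl⟩))⟩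
      · refine ⟨_, h2, ?_⟩
        have := Conn.of_seq (G := G) (Q := Q) (F.x i z) (by omega : 2 ≤ ρ) (fun k hk hk' => ?_)
          (fun a _ ha => F.leg_adj i hi z hzD a (by omega))
        · rwa [F.leg_last i hi z hzD] at this
        rcases Nat.eq_or_lt_of_le hk' with rfl | h1
        · rwa [F.leg_last i hi z hzD]
        · exact Or.inr (Or.inr (Or.inr (Or.inl ⟨k, hk, h1, rfl⟩)))
    obtain ⟨c, h3, h4⟩ := h2
    obtain ⟨l, h5, h6, h7⟩ := (Conn.step hbQ h3 (h4.trans h1.symm)).exists_indPath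
    exact ⟨l, h5, by omega, h7⟩
  obtain ⟨l, h1, h2, h3⟩ := hold
  obtain ⟨l', h1', h2', h3'⟩ := hnew
  exact ⟨_, _, h2, h2', ⟨l, h1, rfl, h3⟩, ⟨l', h1', rfl, h3'⟩⟩

theorem exists_subset_lengths (T : PreTail F X i h B Z u b) (hρ : 3 ≤ ρ) (hX : X ⊆ F.D n)
    (hji : j < i) (hi : i < n) {κ m : ℕ} (hm : (2 * ρ + 1) ^ 2 * κ ≤ m) (hZ : ¬ Col G Z m) :
    ∃ a a' Z', a ≤ 2 * ρ ∧ a' ≤ 2 * ρ ∧ Z' ⊆ Z ∧ ¬ Col G Z' κ ∧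
      ∀ z ∈ Z', HasLengths F i j u (b z) z a a' := by
  have h1 : ∀ z : V, ∃ p : ℕ × ℕ, z ∈ Z → p.1 ≤ 2 * ρ ∧ p.2 ≤ 2 * ρ ∧
      HasLengths F i j u (b z) z p.1 p.2 := by
    intro z
    by_cases hz : z ∈ Z
    · obtain ⟨a, a', h2⟩ := T.exists_lengths hρ hX hji hi hz
      exact ⟨(a, a'), fun _ => h2⟩
    · exact ⟨(0, 0), fun h2 => (hz h2).elim⟩
  choose p hp using h1
  obtain ⟨⟨a, a'⟩, h2, h3⟩ := exists_fiber_not_col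
    (Finset.range (2 * ρ + 1) ×ˢ Finset.range (2 * ρ + 1)) p (fun z hz => by
      have := hp z hz
      simp only [Finset.mem_product, Finset.mem_range]
      omega) (by simpa [sq] using hm) hZ
  simp only [Finset.mem_product, Finset.mem_range] at h2
  refine ⟨a, a', _, by omega, by omega, Set.sep_subset _ _, h3, ?_⟩
  rintro z ⟨hz, hz'⟩
  have := (hp z hz).2.2
  rwa [hz'] at this

/-- Two tails, the first at `z` and the second at a vertex `z'` far away, are joined to a link. -/
theorem linkIn (hρ : 3 ≤ ρ) (hX : X ⊆ F.D n) (hji : j < i) (hi : i < n)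
    {h' : V} {B' Z' : Set V} {u' : V → ℕ → V} {b' : V → V}
    (T : PreTail F X i h B Z u b) (T' : PreTail F X i h' B' Z' u' b') {z z' : V} (hz : z ∈ Z)
    (hz' : z' ∈ Z') {a a₁ c₁ c : ℕ} (hl : HasLengths F i j u (b z) z a a₁)
    (hl' : HasLengths F i j u' (b' z') z' c₁ c)
    (hfar : ∀ y, (y = b z ∨ (∃ k, 2 ≤ k ∧ k ≤ ρ ∧ y = u z k) ∨
      ∃ k, 1 ≤ k ∧ k < ρ ∧ y = F.x i z k) → ¬ Near G (ρ - 1) y z')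
    (hh' : ¬ Near G (ρ - 1) h' z)
    (hV : ¬ (G.Adj (b' z') (u z 2) ∨ G.Adj (b' z') (F.x i z 2))) {M : List V}
    (hM : (M = [] ∧ G.Adj (b z) (b' z')) ∨ (¬ G.Adj (b z) (b' z') ∧ ∃ s s', IndPath G s s' M ∧
      G.Adj (b z) s ∧ G.Adj s' (b' z') ∧ ∀ m ∈ M, m ∈ X ∧ ¬ Near G (ρ - 1) m z ∧
        ¬ Near G (ρ - 1) m z' ∧ (G.Adj (b z) m → m = s) ∧ (G.Adj m (b' z') → m = s'))) :
    LinkIn F X i j (a + M.length + c - 1) := by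
  obtain ⟨⟨l, hl1, rfl, hl2⟩, -⟩ := hl
  obtain ⟨-, l', hl1', rfl, hl2'⟩ := hl'
  have hj : j < n := by omega
  have hzD := hX (T.Z_sub hz)
  have hzD' := hX (T'.Z_sub hz')
  have hbX : b z ∈ X := T.B_sub (T.b_mem z hz)
  have hbX' : b' z' ∈ X := T'.B_sub (T'.b_mem z' hz')
  have hvi : ∀ {y}, y ∈ X → ¬ Near G (ρ - 1) y (F.v i) := fun hy hn =>
    F.not_near hi le_rfl (hX hy) hn.symm
  have hvj : ∀ {y}, y ∈ F.D i → ¬ Near G (ρ - 1) y (F.v j) := fun hy hn =>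
    F.not_near hji hi.le hy hn.symm
  have hXi : ∀ {y}, y ∈ X → y ∈ F.D i := fun hy => F.D_mono hi.le le_rfl (hX hy)
  have hlD : ∀ y ∈ l, y ∈ F.D i := by
    intro y hy
    rcases hl2 y hy with rfl | rfl | ⟨k, hk, hk', rfl⟩ | ⟨k, hk, hk', rfl⟩
    · exact F.v_mem i hi
    · exact hXi hbX
    · exact hXi (T.leg_mem z hz k hk hk')
    · exact F.leg_mem i hi z hzD k hk'.le
  have hlfar : ∀ y ∈ l, ¬ Near G (ρ - 1) y z' := by
    intro y hy
    rcases hl2 y hy with rfl | h1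
    · exact F.not_near hi le_rfl hzD'
    · exact hfar y h1
  have hlcl : ∀ y ∈ l, y = b z ∨ Near G 1 y (F.v i) ∨ y = u z 2 ∨ y = F.x i z 2 ∨
      Near G (ρ - 3) y z := by
    intro y hy
    rcases hl2 y hy with rfl | rfl | ⟨k, hk, hk', rfl⟩ | ⟨k, hk, hk', rfl⟩
    · exact Or.inr (Or.inl (Near.refl _ _))
    · exact Or.inl rfl
    · rcases Nat.eq_or_lt_of_le hk with rfl | h2
      · exact Or.inr (Or.inr (Or.inl rfl))
      · exact Or.inr (Or.inr (Or.inr (Or.inr ((T.leg_near hz hk hk').mono (by omega)))))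
    · rcases Nat.eq_or_lt_of_le hk with rfl | h2
      · exact Or.inr (Or.inl (F.leg_near_hub hi hzD hk'.le).symm)
      rcases Nat.eq_or_lt_of_le h2 with rfl | h3
      · exact Or.inr (Or.inr (Or.inr (Or.inl rfl)))
      · exact Or.inr (Or.inr (Or.inr (Or.inr ((F.leg_near_last hi hzD hk'.le).mono (by omega)))))
  have hlcl2 : ∀ y ∈ l, y = b z ∨ Near G 1 y (F.v i) ∨ Near G (ρ - 2) y z := by
    intro y hy
    rcases hlcl y hy with h1 | h1 | rfl | rfl | h1
    · exact Or.inl h1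
    · exact Or.inr (Or.inl h1)
    · exact Or.inr (Or.inr (T.leg_near hz le_rfl (by omega)))
    · exact Or.inr (Or.inr (F.leg_near_last hi hzD (by omega)))
    · exact Or.inr (Or.inr (h1.mono (by omega)))
  have hlcl' : ∀ y ∈ l', y = b' z' ∨ Near G 1 y (F.v j) ∨ Near G (ρ - 2) y z' := by
    intro y hy
    rcases hl2' y hy with rfl | rfl | ⟨k, hk, hk', rfl⟩ | ⟨k, hk, hk', rfl⟩ | ⟨k, hk, hk', rfl⟩
    · exact Or.inr (Or.inl (Near.refl _ _))
    · exact Or.inl rfl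
    · exact Or.inr (Or.inr ((T'.leg_near hz' hk hk').mono (by omega)))
    · exact Or.inr (Or.inr ((F.leg_near_last hi hzD' hk'.le).mono (by omega)))
    · rcases Nat.eq_or_lt_of_le hk with rfl | h2
      · exact Or.inr (Or.inl (F.leg_near_hub hj hzD' hk'.le).symm)
      · exact Or.inr (Or.inr ((F.leg_near_last hj hzD' hk'.le).mono (by omega)))
  have hb := T.b_near hρ hX hi hz
  have hb' := T'.b_near hρ hX hi hz'
  have hbh' : Near G 1 (b' z') h' := near_of_adj (T'.B_adj _ (T'.b_mem z' hz')).symm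
  -- Vertices of `l'` other than `b' z'` are close to `v j` or within `ρ - 2` of `z'`, both far from
  -- `l`. For `b' z'`, edges to vertices near `v i` are excluded by the frame, those to position two
  -- by `hV`, and those further along by the distance from `h'` to `z`.
  have hcross : ∀ x ∈ l, ∀ y ∈ l', x ≠ y ∧ (G.Adj x y → x = b z ∧ y = b' z') := by
    intro x hx y hy
    rcases hlcl' y hy with rfl | h1 | h1
    · refine ⟨?_, fun hxy => ⟨?_, rfl⟩⟩
      · rintro rfl; exact hlfar _ hx hb'
      · rcases hlcl x hx with h2 | h2 | rfl | rfl | h2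
        · exact h2
        · exact ((ne_and_not_adj_of_near h2 (hvi hbX') (by omega)).2 hxy).elim
        · exact (hV (Or.inl hxy.symm)).elim
        · exact (hV (Or.inr hxy.symm)).elim
        · exact (hh' ((hbh'.symm.trans (near_of_adj hxy.symm)).trans_le h2 (by omega))).elim
    · have := ne_and_not_adj_of_near h1 (hvj (hlD x hx)) (by omega)
      exact ⟨this.1.symm, fun hxy => (this.2 hxy.symm).elim⟩
    · have := ne_and_not_adj_of_near h1 (hlfar x hx) (by omega)
      exact ⟨this.1.symm, fun hxy => (this.2 hxy.symm).elim⟩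
  have hmem : ∀ y, y ∈ l ∨ y ∈ l' → y = F.v i ∨ y = F.v j ∨ y ∈ X ∨
      ∃ z ∈ X, ∃ a, 1 ≤ a ∧ a < ρ ∧ (y = F.x i z a ∨ y = F.x j z a) := by
    rintro y (hy | hy)
    · rcases hl2 y hy with rfl | rfl | ⟨k, hk, hk', rfl⟩ | ⟨k, hk, hk', rfl⟩
      · exact Or.inl rfl
      · exact Or.inr (Or.inr (Or.inl hbX))
      · exact Or.inr (Or.inr (Or.inl (T.leg_mem z hz k hk hk')))
      · exact Or.inr (Or.inr (Or.inr ⟨z, T.Z_sub hz, k, hk, hk', Or.inl rfl⟩))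
    · rcases hl2' y hy with rfl | rfl | ⟨k, hk, hk', rfl⟩ | ⟨k, hk, hk', rfl⟩ | ⟨k, hk, hk', rfl⟩
      · exact Or.inr (Or.inl rfl)
      · exact Or.inr (Or.inr (Or.inl hbX'))
      · exact Or.inr (Or.inr (Or.inl (T'.leg_mem z' hz' k hk hk')))
      · exact Or.inr (Or.inr (Or.inr ⟨z', T'.Z_sub hz', k, by omega, hk', Or.inl rfl⟩))
      · exact Or.inr (Or.inr (Or.inr ⟨z', T'.Z_sub hz', k, hk, hk', Or.inr rfl⟩))
  have hpos := hl1.length_pos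
  have hne := F.hub_ne hji hi
  rcases hM with ⟨rfl, hbb⟩ | ⟨hbb, s, s', hs, hbs, hsb, hM⟩
  · refine LinkIn.of_indPath F hne (hl1.join hl1' hbb hcross) ?_ ?_
    · simp only [List.length_append, List.length_nil]; omega
    · intro y hy
      exact hmem y (List.mem_append.1 hy)
  · have h1 : ∀ m ∈ M, ∀ y ∈ l', m ≠ y ∧ (G.Adj m y → m = s' ∧ y = b' z') := by
      intro m hm y hy
      obtain ⟨hmX, -, hm2, -, hm4⟩ := hM m hm
      rcases hlcl' y hy with rfl | h1 | h1
      · refine ⟨?_, fun hmy => ⟨hm4 hmy, rfl⟩⟩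
        rintro rfl; exact hm2 hb'
      · have := ne_and_not_adj_of_near h1 (hvj (hXi hmX)) (by omega)
        exact ⟨this.1.symm, fun hxy => (this.2 hxy.symm).elim⟩
      · have := ne_and_not_adj_of_near h1 hm2 (by omega)
        exact ⟨this.1.symm, fun hxy => (this.2 hxy.symm).elim⟩
    have h2 := hs.join hl1' hsb h1
    refine LinkIn.of_indPath F hne (hl1.join h2 hbs ?_) ?_ ?_
    · intro x hx y hy
      rcases List.mem_append.1 hy with hy | hy
      · obtain ⟨hmX, hm1, -, hm3, -⟩ := hM y hy
        rcases hlcl2 x hx with rfl | h1 | h1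
        · refine ⟨?_, fun hxy => ⟨rfl, hm3 hxy⟩⟩
          rintro rfl; exact hm1 hb
        · have := ne_and_not_adj_of_near h1 (hvi hmX) (by omega)
          exact ⟨this.1, fun hxy => (this.2 hxy).elim⟩
        · have := ne_and_not_adj_of_near h1 hm1 (by omega)
          exact ⟨this.1, fun hxy => (this.2 hxy).elim⟩
      · refine ⟨(hcross x hx y hy).1, fun hxy => ?_⟩
        obtain ⟨rfl, rfl⟩ := (hcross x hx y hy).2 hxy
        exact (hbb hxy).elim
    · simp only [List.length_append]; omega
    · intro y hy
      rcases List.mem_append.1 hy with hy | hy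
      · exact hmem y (Or.inl hy)
      rcases List.mem_append.1 hy with hy | hy
      · exact Or.inr (Or.inr (Or.inl (hM y hy).1))
      · exact hmem y (Or.inr hy)

/-- A large set contains a vertex far from the part of the first tail at `z`. -/
theorem exists_far (hρ : 3 ≤ ρ) {τ : ℕ} (hB : BallsCol G (ρ - 1) τ) {Y : Set V} (z : V)
    (hY : ¬ Col G Y ((2 * ρ + 1) * τ)) :
    ∃ z' ∈ Y, ∀ y, (y = b z ∨ (∃ k, 2 ≤ k ∧ k ≤ ρ ∧ y = u z k) ∨
      ∃ k, 1 ≤ k ∧ k < ρ ∧ y = F.x i z k) → ¬ Near G (ρ - 1) y z' := by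
  -- One vertex `b z`, `ρ + 1` vertices of `u z` and `ρ - 1` of the leg from `v i`: in all `2 * ρ +
  -- 1` balls.
  set A : List V := b z :: ((List.range (ρ + 1)).map (u z) ++ (List.range (ρ - 1)).map
    (fun k => F.x i z (k + 1)))
  have hA : 0 + A.length * τ ≤ (2 * ρ + 1) * τ := by
    rw [zero_add]
    refine Nat.mul_le_mul_right _ ?_
    simp [A]
    omega
  obtain ⟨z', hz', h1⟩ := nonempty_of_not_col
    (hB.not_col_far A (k := 0) fun hc => hY (hc.mono subset_rfl hA))
  refine ⟨z', hz', fun y hy => h1 y ?_⟩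
  simp only [A, List.mem_cons, List.mem_append, List.mem_map, List.mem_range]
  rcases hy with hy | ⟨k, hk, hk', rfl⟩ | ⟨k, hk, hk', rfl⟩
  · exact Or.inl hy
  · exact Or.inr (Or.inl ⟨k, by omega, rfl⟩)
  · exact Or.inr (Or.inr ⟨k - 1, by omega, by rw [Nat.sub_add_cancel hk]⟩)

/-- Two tails with the same hub give a link through this hub. -/
theorem linkIn_same (hρ : 3 ≤ ρ) (hX : X ⊆ F.D n) (hji : j < i) (hi : i < n) {τ : ℕ}
    (hB : BallsCol G (ρ - 1) τ) {Z' : Set V} {u' : V → ℕ → V} {b' : V → V}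
    (T : PreTail F X i h B Z u b) (T' : PreTail F X i h B Z' u' b') {a a₁ c₁ c : ℕ}
    (hl : ∀ z ∈ Z, HasLengths F i j u (b z) z a a₁)
    (hl' : ∀ z ∈ Z', HasLengths F i j u' (b' z) z c₁ c) {z : V} (hz : z ∈ Z)
    (hZ' : ¬ Col G Z' ((2 * ρ + 1) * τ))
    (hV : ∀ z' ∈ Z', ¬ (G.Adj (b' z') (u z 2) ∨ G.Adj (b' z') (F.x i z 2))) :
    LinkIn F X i j (a + c) := by
  obtain ⟨z', hz', hfar⟩ := exists_far (F := F) (i := i) (u := u) (b := b) hρ hB z hZ'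
  have h1 := linkIn hρ hX hji hi T T' hz hz' (hl z hz) (hl' z' hz') hfar (T.far z hz) (hV z' hz')
    (M := [h]) (Or.inr ⟨T.B_stable _ (T.b_mem z hz) _ (T'.b_mem z' hz'), h, h,
      IndPath.single h, (T.B_adj _ (T.b_mem z hz)).symm, T.B_adj _ (T'.b_mem z' hz'), by
        intro m hm
        rw [List.mem_singleton] at hm
        subst hm
        exact ⟨T.h_mem, T.far z hz, T'.far z' hz', fun _ => rfl, fun _ => rfl⟩⟩)
  have h2 : a + [h].length + c - 1 = a + c := by simp only [List.length_singleton]; omega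
  rwa [h2] at h1

/-- Two tails whose hubs are joined by an edge `s s'` such that `s` is adjacent to the first and
`s'` to the second set of neighbours. -/
theorem linkIn_cross (hρ : 3 ≤ ρ) (hX : X ⊆ F.D n) (hji : j < i) (hi : i < n) {τ : ℕ}
    (hB : BallsCol G (ρ - 1) τ) {h' : V} {B' Z' : Set V} {u' : V → ℕ → V} {b' : V → V}
    (T : PreTail F X i h B Z u b) (T' : PreTail F X i h' B' Z' u' b') {a a₁ c₁ c : ℕ}
    (hl : ∀ z ∈ Z, HasLengths F i j u (b z) z a a₁)
    (hl' : ∀ z ∈ Z', HasLengths F i j u' (b' z) z c₁ c) {z : V} (hz : z ∈ Z)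
    (hZ' : ¬ Col G Z' ((2 * ρ + 1) * τ)) (hh' : ¬ Near G (ρ - 1) h' z)
    (hV : ∀ z' ∈ Z', ¬ (G.Adj (b' z') (u z 2) ∨ G.Adj (b' z') (F.x i z 2)))
    {s s' : V} (hss : G.Adj s s') (hs : s ∈ X) (hs' : s' ∈ X)
    (hsB : ∀ w ∈ B, G.Adj w s) (hsB' : ∀ w ∈ B, ¬ G.Adj w s')
    (hs'B : ∀ w ∈ B', ¬ G.Adj w s) (hs'B' : ∀ w ∈ B', G.Adj w s')
    (hfs : ∀ w, w = z ∨ w ∈ Z' → ¬ Near G (ρ - 1) s w ∧ ¬ Near G (ρ - 1) s' w) :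
    LinkIn F X i j (a + c + 1) ∨ LinkIn F X i j (a + c - 1) := by
  obtain ⟨z', hz', hfar⟩ := exists_far (F := F) (i := i) (u := u) (b := b) hρ hB z hZ'
  by_cases hbb : G.Adj (b z) (b' z')
  · exact Or.inr (linkIn hρ hX hji hi T T' hz hz' (hl z hz) (hl' z' hz') hfar hh' (hV z' hz')
      (M := []) (Or.inl ⟨rfl, hbb⟩))
  · left
    have hbB := T.b_mem z hz
    have hbB' := T'.b_mem z' hz'
    have h1 := linkIn hρ hX hji hi T T' hz hz' (hl z hz) (hl' z' hz') hfar hh' (hV z' hz')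
      (M := [s, s']) (Or.inr ⟨hbb, s, s', IndPath.cons hss (IndPath.single s') (by simp)
        (by simpa using hss.ne), hsB _ hbB, (hs'B' _ hbB').symm, by
        intro m hm
        have f1 := hfs z (Or.inl rfl)
        have f2 := hfs z' (Or.inr hz')
        simp only [List.mem_cons, List.not_mem_nil, or_false] at hm
        rcases hm with rfl | rfl
        · exact ⟨hs, f1.1, f2.1, fun _ => rfl, fun h => (hs'B _ hbB' h.symm).elim⟩
        · exact ⟨hs', f1.2, f2.2, fun h => (hsB' _ hbB h).elim, fun _ => rfl⟩⟩)
    have h2 : a + [s, s'].length + c - 1 = a + c + 1 := by simp; omega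
    rwa [h2] at h1

end PreTail

end

section

variable {V : Type*} {G : SimpleGraph V} {ρ n : ℕ} {r : V → ℕ}

/-! ### Links of consecutive lengths -/

theorem exists_consecutive_of_add {P : ℕ → Prop} {ρ a c : ℕ} (ha : 1 ≤ a) (hc : 1 ≤ c)
    (ha' : a ≤ 2 * ρ) (hc' : c ≤ 2 * ρ) (h : P (a + c)) (h' : P (a + c + 1) ∨ P (a + c - 1)) :
    ∃ k, 1 ≤ k ∧ k ≤ 4 * ρ ∧ P k ∧ P (k + 1) := by
  rcases h' with h' | h'
  · exact ⟨a + c, by omega, by omega, h, h'⟩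
  · refine ⟨a + c - 1, by omega, by omega, h', ?_⟩
    rwa [Nat.sub_add_cancel (by omega)]

theorem HasLengths.pos {F : Frame G ρ r n} {i j a a' : ℕ} {u : V → ℕ → V} {b z : V}
    (h : HasLengths F i j u b z a a') : 1 ≤ a ∧ 1 ≤ a' := by
  obtain ⟨⟨l, h1, rfl, -⟩, l', h1', rfl, -⟩ := h
  exact ⟨h1.length_pos, h1'.length_pos⟩

/-- Large enough to choose a vertex far from a given tail. -/
def farBound (ρ τ : ℕ) : ℕ := (2 * ρ + 1) * τ

/-- Large enough to be split into two parts of size `farBound`. -/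
def splitBound (ρ τ : ℕ) : ℕ := farBound ρ τ + τ + farBound ρ τ

/-- How large the sets of two tails have to be in order to obtain two consecutive lengths. -/
def pairBound (ρ τ : ℕ) : ℕ :=
  splitBound ρ τ + (2 * ρ + 1) ^ 2 * (splitBound ρ τ + τ + splitBound ρ τ)

theorem farBound_le_splitBound (ρ τ : ℕ) : farBound ρ τ ≤ splitBound ρ τ := by
  rw [splitBound]; omega

namespace PreTail

variable [Finite V] {F : Frame G ρ r n} {X : Set V} {i j : ℕ}

/-- For `y ∈ Y` the vertex `b y` precedes `b z`. Since `b z` is first, `b y` has no neighbour at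
position two of the legs of `z`, which is what joining two tails requires. -/
theorem exists_low_high (hr : Function.Injective r) (hρ : 3 ≤ ρ) (hX : X ⊆ F.D n) (hi : i < n)
    {τ : ℕ} (hB : BallsCol G (ρ - 1) τ) {h : V} {B Z Z' : Set V} {u : V → ℕ → V} {b : V → V}
    (T : PreTail F X i h B Z u b) (hZ' : Z' ⊆ Z) (h' : ¬ Col G Z' (splitBound ρ τ)) :
    ∃ z ∈ Z', ∃ Y ⊆ Z', ¬ Col G Y ((2 * ρ + 1) * τ) ∧ ∀ y ∈ Y, r (b y) < r (b z) := by
  obtain ⟨t, h1, h2⟩ := not_col_split (fun z => r (b z))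
    (hB.col_rank_fiber hr b fun z hz => T.b_near hρ hX hi (hZ' hz)) h'
  obtain ⟨z, hz, hz'⟩ := nonempty_of_not_col h2
  exact ⟨z, hz, _, Set.sep_subset _ _, h1, fun y hy => lt_of_le_of_lt hy.2 hz'⟩

/-- A link through a single hub is compared with one through `s, h₂` or a direct edge; both must
have the same end lengths. If many `z ∈ Z₁` have no neighbour of `B₂` at position two, the first
half from `T₁` combines with the second half of `T₁` and of `T₂`. Otherwise `h₂` also acts as a hub
for the legs of `Z₁`, and a third tail, with lengths `a₃, a₃'`, takes part. -/
theorem exists_consecutive_links (hr : Function.Injective r) (hρ : 3 ≤ ρ) (hX : X ⊆ F.D n)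
    (hji : j < i) (hi : i < n) {τ : ℕ} (hB : BallsCol G (ρ - 1) τ) {h₁ h₂ s : V}
    {B₁ Z₁ B₂ Z₂ : Set V} {u₁ u₂ : V → ℕ → V} {b₁ b₂ : V → V}
    (T₁ : PreTail F X i h₁ B₁ Z₁ u₁ b₁) (T₂ : PreTail F X i h₂ B₂ Z₂ u₂ b₂) {a a' : ℕ}
    (ha : a ≤ 2 * ρ) (ha' : a' ≤ 2 * ρ)
    (hl₁ : ∀ z ∈ Z₁, HasLengths F i j u₁ (b₁ z) z a a')
    (hl₂ : ∀ z ∈ Z₂, HasLengths F i j u₂ (b₂ z) z a a')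
    (hZ₁ : ¬ Col G Z₁ (pairBound ρ τ)) (hZ₂ : ¬ Col G Z₂ (pairBound ρ τ))
    (hs : s ∈ X) (hsh : G.Adj s h₂) (hs₁ : ∀ w ∈ B₁, G.Adj w s) (hh₁ : ∀ w ∈ B₁, ¬ G.Adj w h₂)
    (hs₂ : ∀ w ∈ B₂, ¬ G.Adj w s)
    (hfar : ∀ z, z ∈ Z₁ ∨ z ∈ Z₂ → ¬ Near G (ρ - 1) h₁ z ∧ ¬ Near G (ρ - 1) h₂ z ∧
      ¬ Near G (ρ - 1) s z) :
    ∃ c, 1 ≤ c ∧ c ≤ 4 * ρ ∧ LinkIn F X i j c ∧ LinkIn F X i j (c + 1) := by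
  have hB₂ : ∀ w ∈ B₂, G.Adj w h₂ := fun w hw => (T₂.B_adj w hw).symm
  obtain ⟨z₁, hz₁⟩ := nonempty_of_not_col hZ₁
  obtain ⟨hpa, hpa'⟩ := (hl₁ z₁ hz₁).pos
  have hfs := farBound_le_splitBound ρ τ
  have hZ₂' : ¬ Col G Z₂ ((2 * ρ + 1) * τ) := fun hc => hZ₂ (hc.mono subset_rfl (by
    rw [pairBound]; rw [← farBound]; omega))
  rcases not_col_or hZ₁ (fun z => ∀ w ∈ B₂, ¬ (G.Adj w (u₁ z 2) ∨ G.Adj w (F.x i z 2)))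
    with hI | hII
  · obtain ⟨z, hz, Y, hY, hY', hlt⟩ := T₁.exists_low_high hr hρ hX hi hB (Set.sep_subset _ _) hI
    have hYZ : Y ⊆ Z₁ := fun y hy => (hY hy).1
    refine exists_consecutive_of_add hpa hpa' ha ha'
      (linkIn_same hρ hX hji hi hB T₁ (T₁.mono hYZ) hl₁ (fun y hy => hl₁ y (hYZ hy)) hz.1 hY' ?_)
      (linkIn_cross hρ hX hji hi hB T₁ T₂ hl₁ hl₂ hz.1 hZ₂' (hfar z (Or.inl hz.1)).2.1 ?_
        hsh hs T₂.h_mem hs₁ hh₁ hs₂ hB₂ ?_)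
    · intro z' hz' hadj
      exact not_le.2 (hlt z' hz') (T₁.first z hz.1 _ (T₁.b_mem z' (hYZ hz')) hadj)
    · intro z' hz'
      exact hz.2 _ (T₂.b_mem z' hz')
    · rintro w (rfl | hw)
      · exact ⟨(hfar w (Or.inl hz.1)).2.2, (hfar w (Or.inl hz.1)).2.1⟩
      · exact ⟨(hfar w (Or.inr hw)).2.2, (hfar w (Or.inr hw)).2.1⟩
  · set N : Set V := {z ∈ Z₁ | ¬ ∀ w ∈ B₂, ¬ (G.Adj w (u₁ z 2) ∨ G.Adj w (F.x i z 2))}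
    have h1 : ∀ z : V, ∃ w, z ∈ N → (w ∈ B₂ ∧ (G.Adj w (u₁ z 2) ∨ G.Adj w (F.x i z 2))) ∧
        ∀ w' ∈ B₂, G.Adj w' (u₁ z 2) ∨ G.Adj w' (F.x i z 2) → r w ≤ r w' := by
      intro z
      by_cases hz : z ∈ N
      · have := hz.2
        push Not at this
        obtain ⟨w, hw, hw'⟩ := exists_first r
          (P := fun w => w ∈ B₂ ∧ (G.Adj w (u₁ z 2) ∨ G.Adj w (F.x i z 2))) this
        exact ⟨w, fun _ => ⟨hw, fun w' h1 h2 => hw' w' ⟨h1, h2⟩⟩⟩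
      · exact ⟨z, fun hz' => (hz hz').elim⟩
    choose Φ hΦ using h1
    have hNZ : N ⊆ Z₁ := Set.sep_subset _ _
    -- The legs are those of `T₁`, entered from `B₂` instead. Position one of `u₁` plays no role in
    -- a tail, so the hub can be exchanged.
    have T₀ : PreTail F X i h₂ B₂ N u₁ Φ :=
      { h_mem := T₂.h_mem
        B_sub := T₂.B_sub
        B_adj := T₂.B_adj
        B_stable := T₂.B_stable
        Z_sub := hNZ.trans T₁.Z_sub
        far := fun z hz => (hfar z (Or.inl (hNZ hz))).2.1
        leg_last := fun z hz => T₁.leg_last z (hNZ hz)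
        leg_adj := fun z hz => T₁.leg_adj z (hNZ hz)
        leg_mem := fun z hz => T₁.leg_mem z (hNZ hz)
        b_mem := fun z hz => (hΦ z hz).1.1
        b_adj := fun z hz => (hΦ z hz).1.2
        first := fun z hz => (hΦ z hz).2 }
    obtain ⟨a₃, a₃', N', ha₃, ha₃', hN', hN'', hl₃⟩ :=
      T₀.exists_subset_lengths hρ hX hji hi le_rfl hII
    have hN'f : ∀ m, Col G {z ∈ N' | r (Φ z) = m} τ :=
      hB.col_rank_fiber hr Φ fun z hz => T₀.b_near hρ hX hi (hN' hz)
    have hZ₂s : ¬ Col G Z₂ ((2 * ρ + 1) * τ + (2 * ρ + 1) * τ) := fun hc =>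
      hZ₂ (hc.mono subset_rfl (by rw [pairBound, splitBound]; rw [← farBound]; omega))
    obtain ⟨P, hP, R, hR, hP', hR', hcmp⟩ :=
      not_col_compare (fun z => r (Φ z)) (fun z => r (b₂ z)) hN'f hN'' hZ₂s
    have hP₁ : P ⊆ Z₁ := hP.trans (hN'.trans hNZ)
    have T₃ := T₀.mono (hP.trans hN')
    have hl₃' : ∀ z ∈ P, HasLengths F i j u₁ (Φ z) z a₃ a₃' := fun z hz => hl₃ z (hP hz)
    have T₂' := T₂.mono hR
    have hl₂' : ∀ z ∈ R, HasLengths F i j u₂ (b₂ z) z a a' := fun z hz => hl₂ z (hR hz)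
    have T₁' := T₁.mono hP₁
    have hl₁' : ∀ z ∈ P, HasLengths F i j u₁ (b₁ z) z a a' := fun z hz => hl₁ z (hP₁ hz)
    obtain ⟨p, hp⟩ := nonempty_of_not_col hP'
    obtain ⟨hpa₃, hpa₃'⟩ := (hl₃' p hp).pos
    have hfP : ∀ w ∈ P, ¬ Near G (ρ - 1) s w ∧ ¬ Near G (ρ - 1) h₂ w := fun w hw =>
      ⟨(hfar w (Or.inl (hP₁ hw))).2.2, (hfar w (Or.inl (hP₁ hw))).2.1⟩
    rcases hcmp with hcmp | hcmp
    -- Here `Φ` precedes `b₂`. The link through `h₂` goes from `T₂` to `T₃`, the other from `T₁` to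
    -- `T₃`; both have end lengths `a, a₃'`.
    · obtain ⟨y, hy⟩ := nonempty_of_not_col hR'
      obtain ⟨z, hz, Y, hY, hY', hlt⟩ := T₃.exists_low_high hr hρ hX hi hB subset_rfl hP'
      have hPb : ¬ Col G P ((2 * ρ + 1) * τ) := fun hc => hP' (hc.mono subset_rfl hfs)
      refine exists_consecutive_of_add hpa hpa₃' ha ha₃'
        (linkIn_same hρ hX hji hi hB T₂' T₃ hl₂' hl₃' hy hPb ?_)
        (linkIn_cross hρ hX hji hi hB T₁' (T₃.mono hY) hl₁' (fun z hz => hl₃' z (hY hz)) hz hY'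
          (hfP z hz).2 ?_ hsh hs T₂.h_mem hs₁ hh₁ hs₂ hB₂ ?_)
      · intro z' hz' hadj
        exact not_le.2 (hcmp z' hz' y hy) (T₂'.first y hy _ (T₃.b_mem z' hz') hadj)
      · intro z' hz' hadj
        exact not_le.2 (hlt z' hz') (T₃.first z hz _ (T₃.b_mem z' (hY hz')) hadj)
      · rintro w (rfl | hw)
        · exact hfP w hz
        · exact hfP w (hY hw)
    -- Here `b₂` precedes `Φ`. The links go from `T₃` to `T₂` through `h₂`, and from `T₃` to `T₁`
    -- through `h₂, s` in this order or a direct edge; both have end lengths `a₃, a'`.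
    · obtain ⟨z, hz, Y, hY, hY', hlt⟩ := T₁'.exists_low_high hr hρ hX hi hB subset_rfl hP'
      refine exists_consecutive_of_add hpa₃ hpa' ha₃ ha'
        (linkIn_same hρ hX hji hi hB T₃ T₂' hl₃' hl₂' hp hR' ?_)
        (linkIn_cross hρ hX hji hi hB T₃ (T₁'.mono hY) hl₃' (fun z hz => hl₁' z (hY hz)) hz hY'
          (hfar z (Or.inl (hP₁ hz))).1 ?_ hsh.symm T₂.h_mem hs hB₂ hs₂ hh₁ hs₁ ?_)
      · intro z' hz' hadj
        exact not_le.2 (hcmp p hp z' hz') (T₃.first p hp _ (T₂'.b_mem z' hz') hadj)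
      · intro z' hz' hadj
        exact not_le.2 (hlt z' hz') (T₁'.first z hz _ (T₁'.b_mem z' (hY hz')) hadj)
      · rintro w (rfl | hw)
        · exact (hfP w hz).symm
        · exact (hfP w (hY hw)).symm

end PreTail

/-! ### Maximum cliques of hubs -/

/-- Every set that is not `τ`-colourable contains a maximum clique of `G`. -/
def MaxCliques (G : SimpleGraph V) (τ : ℕ) : Prop :=
  ∀ S : Set V, ¬ Col G S τ → ∃ K : Finset V, (∀ x ∈ K, x ∈ S) ∧ G.IsNClique G.cliqueNum K

/-- How large the sets attached to the hubs of a maximum clique have to be. -/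
def tailBound (ρ τ : ℕ) : ℕ := 2 ^ τ * (pairBound ρ τ + τ * τ)

/-- How large a set must be to provide links of consecutive lengths. -/
def gadgetBound (φ : ℕ → ℕ) (ρ τ : ℕ) : ℕ :=
  φ (τ + τ * ((2 * ρ + 1) ^ 2 * tailBound ρ τ)) + (2 * ρ + 1) ^ 2 * τ

theorem exists_tail_of_hubAt {F : Frame G ρ r n} {X : Set V} {i j κ : ℕ} (hρ : 3 ≤ ρ)
    (hX : X ⊆ F.D n) (hji : j < i) (hi : i < n) {h : V} (hh : h ∈ X)
    (hH : HubAt G ρ r X h ((2 * ρ + 1) ^ 2 * κ)) :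
    ∃ a a' B Z u b, a ≤ 2 * ρ ∧ a' ≤ 2 * ρ ∧ PreTail F X i h B Z u b ∧ ¬ Col G Z κ ∧
      ∀ z ∈ Z, HasLengths F i j u (b z) z a a' := by
  obtain ⟨B, Z, u, H, hZ⟩ := hH
  have h1 : ∀ z : V, ∃ w, z ∈ Z → (w ∈ B ∧ (G.Adj w (u z 2) ∨ G.Adj w (F.x i z 2))) ∧
      ∀ w' ∈ B, G.Adj w' (u z 2) ∨ G.Adj w' (F.x i z 2) → r w ≤ r w' := by
    intro z
    by_cases hz : z ∈ Z
    · obtain ⟨w, hw, hw'⟩ := exists_first r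
        (P := fun w => w ∈ B ∧ (G.Adj w (u z 2) ∨ G.Adj w (F.x i z 2)))
        ⟨u z 1, H.leg_one z hz, Or.inl (H.leg_adj z hz 1 (by omega))⟩
      exact ⟨w, fun _ => ⟨hw, fun w' h1 h2 => hw' w' ⟨h1, h2⟩⟩⟩
    · exact ⟨z, fun hz' => (hz hz').elim⟩
  choose b hb using h1
  have T : PreTail F X i h B Z u b :=
    { h_mem := hh
      B_sub := H.B_sub
      B_adj := H.B_adj
      B_stable := H.B_stable
      Z_sub := H.Z_sub
      far := H.far
      leg_last := H.leg_last
      leg_adj := fun z hz k _ hk => H.leg_adj z hz k hk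
      leg_mem := fun z hz k _ hk => H.leg_mem z hz k hk
      b_mem := fun z hz => (hb z hz).1.1
      b_adj := fun z hz => (hb z hz).1.2
      first := fun z hz => (hb z hz).2 }
  obtain ⟨a, a', Z', ha, ha', hZ', hZ'', hl⟩ :=
    T.exists_subset_lengths hρ hX hji hi le_rfl hZ
  exact ⟨a, a', B, Z', u, b, ha, ha', T.mono hZ', hZ'', hl⟩

/-- Sorting the hubs by their pair of lengths leaves a set that is not `τ`-colourable, hence a
maximum clique of hubs. Maximality of the clique, and of the trace of `B₁` on it, produces the
vertices `h₂` and `s` that distinguish two tails. -/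
theorem exists_consecutive_links [Finite V] {φ : ℕ → ℕ} {τ : ℕ} (F : Frame G ρ r n)
    (hr : Function.Injective r) (hρ : 3 ≤ ρ) (hB : BallsCol G (ρ - 1) τ)
    (hC : BallControl G ρ φ) (hω : MaxCliques G τ) {X : Set V} (hX : X ⊆ F.D n) {i j : ℕ}
    (hji : j < i) (hi : i < n) (h : ¬ Col G X (gadgetBound φ ρ τ)) :
    ∃ c, 1 ≤ c ∧ c ≤ 4 * ρ ∧ LinkIn F X i j c ∧ LinkIn F X i j (c + 1) := by
  classical
  set H₀ : Set V := {h ∈ X | HubAt G ρ r X h ((2 * ρ + 1) ^ 2 * tailBound ρ τ)}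
  have h1 : ¬ Col G H₀ ((2 * ρ + 1) ^ 2 * τ) := by
    intro hc
    refine h ((col_not_hubAt (r := r) hρ hB hC X).of_subset_union hc fun x hx => ?_)
    by_cases hx' : HubAt G ρ r X x ((2 * ρ + 1) ^ 2 * tailBound ρ τ)
    · exact Or.inr ⟨hx, hx'⟩
    · exact Or.inl ⟨hx, hx'⟩
  have h2 : ∀ h : V, ∃ p : ℕ × ℕ, h ∈ H₀ → ∃ B Z u b, p.1 ≤ 2 * ρ ∧ p.2 ≤ 2 * ρ ∧
      PreTail F X i h B Z u b ∧ ¬ Col G Z (tailBound ρ τ) ∧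
      ∀ z ∈ Z, HasLengths F i j u (b z) z p.1 p.2 := by
    intro h
    by_cases hh : h ∈ H₀
    · obtain ⟨a, a', h3⟩ := exists_tail_of_hubAt hρ hX hji hi hh.1 hh.2
      exact ⟨(a, a'), fun _ => h3⟩
    · exact ⟨(0, 0), fun hh' => (hh hh').elim⟩
  choose p hp using h2
  obtain ⟨⟨a, a'⟩, haa, hH⟩ := exists_fiber_not_col (k := τ)
    (Finset.range (2 * ρ + 1) ×ˢ Finset.range (2 * ρ + 1)) p (fun z hz => by
      obtain ⟨_, _, _, _, h3, h4, -⟩ := hp z hz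
      simp only [Finset.mem_product, Finset.mem_range]
      omega) (by simp [sq]) h1
  simp only [Finset.mem_product, Finset.mem_range] at haa
  obtain ⟨K, hKH, hK⟩ := hω _ hH
  obtain ⟨h₀, hh₀⟩ := nonempty_of_not_col hH
  have hωpos : 1 ≤ G.cliqueNum := by
    have : G.IsClique (({h₀} : Finset V) : Set V) := by simp
    simpa using this.card_le_cliqueNum
  -- A clique lies in the ball around any of its vertices, so it uses at most `τ` colours. This
  -- bounds the number of traces by `2 ^ τ`.
  have hKτ : K.card ≤ τ := by
    obtain ⟨k, hk⟩ : K.Nonempty := by rw [← Finset.card_pos, hK.card_eq]; omega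
    refine (hB k).card_clique_le hK.isClique fun x hx => ?_
    by_cases hxk : x = k
    · subst hxk; exact Near.refl _ _
    · exact (near_of_adj (hK.isClique hk hx (Ne.symm hxk))).mono (by omega)
  have hKne : ∀ w, ∃ k ∈ K, ¬ G.Adj w k := by
    intro w
    by_contra hn
    push Not at hn
    have hc : G.IsClique ((insert w K : Finset V) : Set V) := by
      rw [Finset.coe_insert, isClique_insert]
      exact ⟨hK.isClique, fun b hb _ => hn b hb⟩
    have h3 := hc.card_le_cliqueNum
    rw [Finset.card_insert_of_notMem (fun hw => (hn w hw).ne rfl), hK.card_eq] at h3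
    omega
  have h3 : ∀ h : V, ∃ S : Finset V, h ∈ K → h ∈ S ∧ S ⊆ K ∧ ∃ B Z u b,
      PreTail F X i h B Z u b ∧ ¬ Col G Z (pairBound ρ τ) ∧
      (∀ z ∈ Z, HasLengths F i j u (b z) z a a') ∧
      (∀ w ∈ B, ∀ k ∈ K, G.Adj w k ↔ k ∈ S) ∧ ∀ z ∈ Z, ∀ k ∈ K, ¬ Near G (ρ - 1) k z := by
    intro h
    by_cases hh : h ∈ K
    swap
    · exact ⟨∅, fun hh' => (hh hh').elim⟩
    obtain ⟨hhH, hpa⟩ := hKH h hh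
    obtain ⟨B, Z, u, b, -, -, T, hZ, hl⟩ := hp h hhH
    rw [hpa] at hl
    -- First fix the trace of `b z` on `K`, then move away from all of `K`; afterwards `B` is cut
    -- down to the vertices with this trace.
    obtain ⟨S, hS, hZS⟩ := exists_fiber_not_col (k := pairBound ρ τ + τ * τ) K.powerset
      (fun z => K.filter (fun k => G.Adj (b z) k)) (fun z _ => by simp) (by
        rw [Finset.card_powerset, tailBound]
        exact Nat.mul_le_mul_right _ (Nat.pow_le_pow_right (by omega) hKτ)) hZ
    rw [Finset.mem_powerset] at hS
    have hZ' := hB.not_col_far K.toList (k := pairBound ρ τ) (N := {z ∈ Z | K.filter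
      (fun k => G.Adj (b z) k) = S}) (fun hc => hZS (hc.mono subset_rfl (by
        rw [Finset.length_toList]
        exact Nat.add_le_add_left (Nat.mul_le_mul_right _ hKτ) _)))
    have T' := T.mono (Z' := {z ∈ {z ∈ Z | K.filter (fun k => G.Adj (b z) k) = S} |
      ∀ w ∈ K.toList, ¬ Near G (ρ - 1) w z}) (fun z hz => hz.1.1)
    have T'' := T'.mono_B (B' := {w ∈ B | K.filter (fun k => G.Adj w k) = S})
      (Set.sep_subset _ _) (fun z hz => ⟨T.b_mem z hz.1.1, hz.1.2⟩)
    refine ⟨S, fun _ => ⟨?_, hS, _, _, u, b, T'', hZ', fun z hz => hl z hz.1.1, ?_, ?_⟩⟩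
    · obtain ⟨z, hz⟩ := nonempty_of_not_col hZ'
      rw [← hz.1.2, Finset.mem_filter]
      exact ⟨hh, (T.B_adj _ (T.b_mem z hz.1.1)).symm⟩
    · rintro w ⟨-, rfl⟩ k hk
      simp [hk]
    · intro z hz k hk
      exact hz.2 k (Finset.mem_toList.2 hk)
  choose S hS using h3
  obtain ⟨k₀, hk₀⟩ : K.Nonempty := by rw [← Finset.card_pos, hK.card_eq]; omega
  obtain ⟨h₁, hh₁, hmax⟩ := K.exists_max_image (fun h => (S h).card) ⟨k₀, hk₀⟩
  obtain ⟨hS₁, hSK₁, B₁, Z₁, u₁, b₁, T₁, hZ₁, hl₁, hB₁, hf₁⟩ := hS h₁ hh₁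
  obtain ⟨z₁, hz₁⟩ := nonempty_of_not_col hZ₁
  obtain ⟨h₂, hh₂, hh₂'⟩ := hKne (b₁ z₁)
  rw [hB₁ _ (T₁.b_mem z₁ hz₁) _ hh₂] at hh₂'
  obtain ⟨hS₂, hSK₂, B₂, Z₂, u₂, b₂, T₂, hZ₂, hl₂, hB₂, hf₂⟩ := hS h₂ hh₂
  -- If `S h₁ ⊆ S h₂`, the choice of `h₁` forces equality, but `h₂` belongs only to `S h₂`.
  obtain ⟨s, hs₁, hs₂⟩ : ∃ s ∈ S h₁, s ∉ S h₂ := by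
    by_contra hn
    push Not at hn
    have := Finset.eq_of_subset_of_card_le hn (hmax h₂ hh₂)
    exact hh₂' (this ▸ hS₂)
  have hsK := hSK₁ hs₁
  have hsh : s ≠ h₂ := by rintro rfl; exact hh₂' hs₁
  refine T₁.exists_consecutive_links hr hρ hX hji hi hB T₂ (by omega) (by omega) hl₁ hl₂ hZ₁ hZ₂
    (hKH s hsK).1.1 (hK.isClique hsK hh₂ hsh) (fun w hw => (hB₁ w hw s hsK).2 hs₁)
    (fun w hw => fun hadj => hh₂' ((hB₁ w hw h₂ hh₂).1 hadj))
    (fun w hw => fun hadj => hs₂ ((hB₂ w hw s hsK).1 hadj)) ?_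
  rintro z (hz | hz)
  · exact ⟨hf₁ z hz h₁ hh₁, hf₁ z hz h₂ hh₂, hf₁ z hz s hsK⟩
  · exact ⟨hf₂ z hz h₁ hh₁, hf₂ z hz h₂ hh₂, hf₂ z hz s hsK⟩

end

section

variable {V : Type*} {G : SimpleGraph V} {ρ n : ℕ} {r : V → ℕ}

/-! ### Chains of links -/

/-- `γ l z` is the first vertex of `B l` with a neighbour at position two on a leg of `z`. -/
structure IsGate (F : Frame G ρ r n) (γ : ℕ → V → V) : Prop where
  mem : ∀ l < n, ∀ z ∈ F.D n, γ l z ∈ F.B l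
  adj : ∀ l < n, ∀ z ∈ F.D n, ∃ k < n, G.Adj (γ l z) (F.x k z 2)
  first : ∀ l < n, ∀ z ∈ F.D n, ∀ g ∈ F.B l, (∃ k < n, G.Adj g (F.x k z 2)) → r (γ l z) ≤ r g

theorem exists_isGate (F : Frame G ρ r n) (hρ : 3 ≤ ρ) : ∃ γ, IsGate F γ := by
  have h : ∀ (l : ℕ) (z : V), ∃ g, l < n → z ∈ F.D n → (g ∈ F.B l ∧ ∃ k < n, G.Adj g (F.x k z 2)) ∧
      ∀ g' ∈ F.B l, (∃ k < n, G.Adj g' (F.x k z 2)) → r g ≤ r g' := by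
    intro l z
    by_cases hlz : l < n ∧ z ∈ F.D n
    · obtain ⟨g, hg, hg'⟩ := exists_first r
        (P := fun g => g ∈ F.B l ∧ ∃ k < n, G.Adj g (F.x k z 2))
        ⟨F.x l z 1, F.leg_one l hlz.1 z hlz.2, l, hlz.1, F.leg_adj l hlz.1 z hlz.2 1 (by omega)⟩
      exact ⟨g, fun _ _ => ⟨hg, fun g' h1 h2 => hg' g' ⟨h1, h2⟩⟩⟩
    · exact ⟨z, fun h1 h2 => (hlz ⟨h1, h2⟩).elim⟩
  choose γ hγ using h
  exact ⟨γ, fun l hl z hz => (hγ l z hl hz).1.1, fun l hl z hz => (hγ l z hl hz).1.2,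
    fun l hl z hz => (hγ l z hl hz).2⟩

theorem IsGate.near {F : Frame G ρ r n} {γ : ℕ → V → V} (hγ : IsGate F γ) (hρ : 3 ≤ ρ) {l : ℕ}
    (hl : l < n) {z : V} (hz : z ∈ F.D n) : Near G (ρ - 1) (γ l z) z := by
  obtain ⟨k, hk, h⟩ := hγ.adj l hl z hz
  exact (near_of_adj h).trans_le (F.leg_near_last hk hz (by omega : 2 ≤ ρ)) (by omega)

theorem IsGate.hub_adj {F : Frame G ρ r n} {γ : ℕ → V → V} (hγ : IsGate F γ) {l : ℕ}
    (hl : l < n) {z : V} (hz : z ∈ F.D n) : G.Adj (F.v l) (γ l z) :=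
  F.B_adj l hl _ (hγ.mem l hl z hz)

/-- A chain of links from `v b` to `v i`, which provides induced paths of `t + 1` consecutive
lengths with vertices in `W`. The sets `Y` and `R` are reserved for further links and for the
final connection. -/
structure Chain (F : Frame G ρ r n) (γ : ℕ → V → V) (J : Finset ℕ) (b i base t : ℕ) (W : List V)
    (Y R : Set V) : Prop where
  path : ∀ e ≤ t, ∃ l, IndPath G (F.v b) (F.v i) l ∧ l.length = base + e + 1 ∧ ∀ u ∈ l, u ∈ W
  W_mem : ∀ w ∈ W, w ∈ F.D i
  Y_sub : Y ⊆ F.D n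
  R_sub : R ⊆ F.D n
  lt : ∀ l ∈ J, ∀ z ∈ R, ∀ z' ∈ Y, r (γ l z) < r (γ l z')
  far_Y : ∀ w ∈ W, ∀ z ∈ Y, ¬ Near G (ρ - 1) w z
  far_R : ∀ w ∈ W, ∀ z ∈ R, ¬ Near G (ρ - 1) w z
  first : ∀ w ∈ W, ∀ z ∈ Y, w = F.v i ∨ ¬ G.Adj (F.x i z 1) w
  gate : ∀ w ∈ W, ∀ z ∈ R, ∀ l ∈ J, w = F.v l ∨ ¬ G.Adj (γ l z) w

theorem Frame.not_adj_of_near_hub (F : Frame G ρ r n) (hρ : 3 ≤ ρ) {j k : ℕ} (hjk : j < k)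
    (hk : k ≤ n) {x y : V} (hx : Near G 1 x (F.v j)) (hy : y ∈ F.D k) : x ≠ y ∧ ¬ G.Adj x y :=
  ne_and_not_adj_of_near hx (fun h => F.not_near hjk hk hy h.symm) (by omega)

/-- A gate is not adjacent to the inner vertices of the legs of a vertex with larger gate. -/
theorem IsGate.not_adj_leg {F : Frame G ρ r n} {γ : ℕ → V → V} (hγ : IsGate F γ) (hρ : 3 ≤ ρ)
    {l i a : ℕ} (hl : l < n) (hi : i < n) {z z' : V} (hz : z ∈ F.D n) (hz' : z' ∈ F.D n)
    (hlt : r (γ l z) < r (γ l z')) (ha : 1 ≤ a) (ha' : a < ρ) :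
    ¬ G.Adj (γ l z) (F.x i z' a) := by
  intro hadj
  have hnear : Near G 1 (γ l z) (F.v l) := (near_of_adj (hγ.hub_adj hl hz)).symm
  have hγD : γ l z ∈ F.D l := F.B_sub l hl (hγ.mem l hl z hz)
  rcases Nat.eq_or_lt_of_le ha with rfl | h1
  · rcases lt_trichotomy l i with h2 | rfl | h2
    · exact (F.not_adj_of_near_hub hρ h2 hi.le hnear (F.leg_mem i hi z' hz' 1 ha'.le)).2 hadj
    · exact F.B_stable l hl _ (hγ.mem l hl z hz) _ (F.leg_one l hl z' hz') hadj
    · exact (F.not_adj_of_near_hub hρ h2 hl.le (F.leg_near_hub hi hz' ha'.le).symm hγD).2 hadj.symm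
  rcases Nat.eq_or_lt_of_le h1 with rfl | h2
  · exact not_le.2 hlt (hγ.first l hl z' hz' _ (hγ.mem l hl z hz) ⟨i, hi, hadj⟩)
  · exact F.not_near hl le_rfl hz' ((hnear.symm.trans (near_of_adj hadj)).trans_le
      (F.leg_near_last hi hz' ha'.le) (by omega))

theorem IsGate.not_adj_hub {F : Frame G ρ r n} {γ : ℕ → V → V} (hγ : IsGate F γ) (hρ : 3 ≤ ρ)
    {l j : ℕ} (hl : l < n) (hj : j < n) (hlj : l ≠ j) {z : V} (hz : z ∈ F.D n) :
    ¬ G.Adj (γ l z) (F.v j) := by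
  intro hadj
  rcases Nat.lt_or_gt_of_ne hlj with h | h
  · exact (F.not_adj_of_near_hub hρ h hj.le (near_of_adj (hγ.hub_adj hl hz)).symm
      (F.v_mem j hj)).2 hadj
  · exact (F.not_adj_of_near_hub hρ h hl.le (Near.refl _ _)
      (F.B_sub l hl (hγ.mem l hl z hz))).2 hadj.symm

namespace Chain

variable {F : Frame G ρ r n} {γ : ℕ → V → V} {J : Finset ℕ} {b i base t : ℕ} {W : List V}
  {Y R : Set V}

/-- Extend a chain by links in a part `X` of `Y`. -/
theorem extend (hρ : 3 ≤ ρ) (hγ : IsGate F γ) (hJ : ∀ l ∈ J, l < n)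
    (c : Chain F γ J b i base t W Y R) {j t₀ base' t' : ℕ} (hji : j < i) (hi : i < n)
    {A : List V} (hA : ∀ u ∈ A, u ∈ {z ∈ Y | t₀ < r (F.x j z 1)} ∨
      ∃ z ∈ {z ∈ Y | t₀ < r (F.x j z 1)}, ∃ a, 1 ≤ a ∧ a < ρ ∧ (u = F.x i z a ∨ u = F.x j z a))
    (hpath : ∀ e ≤ t', ∃ e₀ ≤ t, ∃ m : List V,
      IndPath G (F.v i) (F.v j) (F.v i :: (m ++ [F.v j])) ∧ (∀ u ∈ m, u ∈ A) ∧
      base + e₀ + (m.length + 1) = base' + e) :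
    Chain F γ J b j base' t' (F.v j :: (A ++ W))
      {z ∈ {z ∈ Y | r (F.x j z 1) ≤ t₀} | ∀ w ∈ A, ¬ Near G (ρ - 1) w z}
      {z ∈ R | ∀ w ∈ A, ¬ Near G (ρ - 1) w z} := by
  have hj : j < n := by omega
  have hADi : ∀ u ∈ A, u ∈ F.D i ∨ ∃ z ∈ Y, t₀ < r (F.x j z 1) ∧ ∃ a, 1 ≤ a ∧ a < ρ ∧
      u = F.x j z a := by
    intro u hu
    rcases hA u hu with h1 | ⟨z, hz, a, ha, ha', rfl | rfl⟩
    · exact Or.inl (F.D_mono hi.le le_rfl (c.Y_sub h1.1))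
    · exact Or.inl (F.leg_mem i hi z (c.Y_sub hz.1) a ha'.le)
    · exact Or.inr ⟨z, hz.1, hz.2, a, ha, ha', rfl⟩
  have hvC : ∀ {z}, z ∈ F.D n → ¬ Near G (ρ - 1) (F.v j) z := fun hz => F.not_near hj le_rfl hz
  refine ⟨?_, ?_, fun z hz => c.Y_sub hz.1.1, fun z hz => c.R_sub hz.1,
    fun l hl z hz z' hz' => c.lt l hl z hz.1 z' hz'.1.1, ?_, ?_, ?_, ?_⟩
  · intro e he
    obtain ⟨e₀, he₀, m, hm, hmA, hlen⟩ := hpath e he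
    obtain ⟨l, hl, hl', hlW⟩ := c.path e₀ he₀
    refine ⟨l ++ (m ++ [F.v j]), hl.trans hm ?_, ?_, ?_⟩
    · intro x hx y hy
      by_cases hxi : x = F.v i
      · subst hxi
        obtain ⟨l', h1, h2⟩ := hm.eq_cons
        rw [List.cons.injEq] at h1
        rw [← h1.2] at h2
        refine ⟨?_, fun _ => rfl⟩
        rintro rfl
        exact h2 hy
      · suffices h : x ≠ y ∧ ¬ G.Adj x y from ⟨h.1, fun h' => (h.2 h').elim⟩
        have hxD := c.W_mem x (hlW x hx)
        have hxj : ∀ {y}, Near G 1 y (F.v j) → x ≠ y ∧ ¬ G.Adj x y := fun hy =>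
          have := F.not_adj_of_near_hub hρ hji hi.le hy hxD
          ⟨this.1.symm, fun h => this.2 h.symm⟩
        have hxz : ∀ {y z}, z ∈ Y → Near G (ρ - 2) y z → x ≠ y ∧ ¬ G.Adj x y := fun hz hy =>
          have := ne_and_not_adj_of_near hy (c.far_Y x (hlW x hx) _ hz) (by omega)
          ⟨this.1.symm, fun h => this.2 h.symm⟩
        rcases List.mem_append.1 hy with hy | hy
        · rcases hA y (hmA y hy) with h1 | ⟨z, hz, a, ha, ha', h1⟩
          · exact hxz h1.1 (Near.refl _ _)
          · have hzD := c.Y_sub hz.1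
            rcases Nat.eq_or_lt_of_le ha with rfl | h2
            · rcases h1 with rfl | rfl
              · refine ⟨?_, fun h => ?_⟩
                · rintro rfl
                  exact c.far_Y _ (hlW _ hx) z hz.1 (F.leg_near_last hi hzD ha'.le)
                · exact (c.first x (hlW x hx) z hz.1).resolve_left hxi h.symm
              · exact hxj (F.leg_near_hub hj hzD ha'.le).symm
            · rcases h1 with rfl | rfl
              · exact hxz hz.1 ((F.leg_near_last hi hzD ha'.le).mono (by omega))
              · exact hxz hz.1 ((F.leg_near_last hj hzD ha'.le).mono (by omega))
        · rw [List.mem_singleton] at hy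
          exact hxj (hy ▸ Near.refl _ _)
    · simp only [List.length_append, List.length_singleton]; omega
    · intro u hu
      simp only [List.mem_append, List.mem_singleton] at hu
      simp only [List.mem_cons, List.mem_append]
      rcases hu with hu | hu | hu
      · exact Or.inr (Or.inr (hlW u hu))
      · exact Or.inr (Or.inl (hmA u hu))
      · exact Or.inl hu
  · intro w hw
    simp only [List.mem_cons, List.mem_append] at hw
    rcases hw with rfl | hw | hw
    · exact F.v_mem j hj
    · rcases hADi w hw with h1 | ⟨z, hz, -, a, ha, ha', rfl⟩
      · exact F.D_mono hji.le hi.le h1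
      · exact F.leg_mem j hj z (c.Y_sub hz) a ha'.le
    · exact F.D_mono hji.le hi.le (c.W_mem w hw)
  · intro w hw z hz
    simp only [List.mem_cons, List.mem_append] at hw
    rcases hw with rfl | hw | hw
    · exact hvC (c.Y_sub hz.1.1)
    · exact hz.2 w hw
    · exact c.far_Y w hw z hz.1.1
  · intro w hw z hz
    simp only [List.mem_cons, List.mem_append] at hw
    rcases hw with rfl | hw | hw
    · exact hvC (c.R_sub hz.1)
    · exact hz.2 w hw
    · exact c.far_R w hw z hz.1
  · intro w hw z hz
    have hzD := c.Y_sub hz.1.1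
    have h1 : Near G 1 (F.x j z 1) (F.v j) := (F.leg_near_hub hj hzD (by omega)).symm
    have h2 : w ∈ F.D i → ¬ G.Adj (F.x j z 1) w := fun hw =>
      (F.not_adj_of_near_hub hρ hji hi.le h1 hw).2
    simp only [List.mem_cons, List.mem_append] at hw
    rcases hw with rfl | hw | hw
    · exact Or.inl rfl
    · right
      rcases hADi w hw with h3 | ⟨z', hz', hlt, a, ha, ha', rfl⟩
      · exact h2 h3
      · intro hadj
        have hzD' := c.Y_sub hz'
        rcases Nat.eq_or_lt_of_le ha with rfl | h4
        · exact F.B_stable j hj _ (F.leg_one j hj z hzD) _ (F.leg_one j hj z' hzD') hadj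
        rcases Nat.eq_or_lt_of_le h4 with rfl | h5
        -- The threshold `t₀` serves here: reserved vertices have the rank at most `t₀` and link
        -- vertices have it above `t₀`, so this edge would contradict the choice of `x j z' 1` as
        -- first.
        · have h6 := F.first j hj z' hzD' _ (F.leg_one j hj z hzD) hadj
          have h7 : r (F.x j z 1) ≤ t₀ := hz.1.2
          omega
        · exact hvC hzD' ((h1.symm.trans (near_of_adj hadj)).trans_le
            (F.leg_near_last hj hzD' ha'.le) (by omega))
    · exact Or.inr (h2 (c.W_mem w hw))
  · intro w hw z hz l hl
    have hzD := c.R_sub hz.1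
    have hln := hJ l hl
    have h1 : Near G 1 (γ l z) (F.v l) := (near_of_adj (hγ.hub_adj hln hzD)).symm
    simp only [List.mem_cons, List.mem_append] at hw
    rcases hw with rfl | hw | hw
    · by_cases hlj : l = j
      · exact Or.inl (by rw [hlj])
      · exact Or.inr (hγ.not_adj_hub hρ hln hj hlj hzD)
    · right
      rcases hA w hw with h2 | ⟨z', hz', a, ha, ha', h2⟩
      · exact (F.not_adj_of_near_hub hρ hln le_rfl h1 (c.Y_sub h2.1)).2
      · have hlt := c.lt l hl z hz.1 z' hz'.1
        rcases h2 with rfl | rfl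
        · exact hγ.not_adj_leg hρ hln hi hzD (c.Y_sub hz'.1) hlt ha ha'
        · exact hγ.not_adj_leg hρ hln hj hzD (c.Y_sub hz'.1) hlt ha ha'
    · exact c.gate w hw z hz.1 l hl

end Chain

/-- How large the reserved sets have to be so that they are still `K`-large after one more
link. -/
def stepBound (φ : ℕ → ℕ) (ρ τ K : ℕ) : ℕ := (K + 8 * ρ * τ) + τ + gadgetBound φ ρ τ

namespace Chain

variable [Finite V] {F : Frame G ρ r n} {γ : ℕ → V → V} {J : Finset ℕ} {b i base t : ℕ}
  {W : List V} {Y R : Set V} {φ : ℕ → ℕ} {τ K : ℕ}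

/-- The high part of `Y` supplies the link and the low part stays reserved. Two links of lengths `L
≤ 4 * ρ` and `L + 1` have fewer than `8 * ρ` inner vertices together, which bounds the cost of
moving away from them. -/
theorem step_aux (hr : Function.Injective r) (hρ : 3 ≤ ρ) (hB : BallsCol G (ρ - 1) τ)
    (c : Chain F γ J b i base t W Y R) {j : ℕ} (hj : j < n)
    (hY : ¬ Col G Y (stepBound φ ρ τ K)) (hR : ¬ Col G R (stepBound φ ρ τ K)) :
    ∃ t₀, ¬ Col G {z ∈ Y | t₀ < r (F.x j z 1)} (gadgetBound φ ρ τ) ∧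
      ∀ A : List V, A.length ≤ 8 * ρ →
        ¬ Col G {z ∈ {z ∈ Y | r (F.x j z 1) ≤ t₀} | ∀ w ∈ A, ¬ Near G (ρ - 1) w z} K ∧
        ¬ Col G {z ∈ R | ∀ w ∈ A, ¬ Near G (ρ - 1) w z} K := by
  obtain ⟨t₀, h1, h2⟩ := not_col_split (fun z => r (F.x j z 1))
    (hB.col_rank_fiber hr (fun z => F.x j z 1) fun z hz =>
      F.leg_near_last hj (c.Y_sub hz) (by omega)) hY
  refine ⟨t₀, h2, fun A hA => ⟨hB.not_col_far A fun hc => h1 (hc.mono subset_rfl ?_),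
    hB.not_col_far A fun hc => hR (hc.mono subset_rfl ?_)⟩⟩
  · exact Nat.add_le_add_left (Nat.mul_le_mul_right _ hA) _
  · have := Nat.mul_le_mul_right τ hA
    rw [stepBound]; omega

/-- One more link, and one more length. -/
theorem exists_gadget_step (hr : Function.Injective r) (hρ : 3 ≤ ρ)
    (hB : BallsCol G (ρ - 1) τ) (hC : BallControl G ρ φ) (hω : MaxCliques G τ)
    (hγ : IsGate F γ) (hJ : ∀ l ∈ J, l < n) (c : Chain F γ J b i base t W Y R) {j : ℕ}
    (hji : j < i) (hi : i < n)
    (hY : ¬ Col G Y (stepBound φ ρ τ K)) (hR : ¬ Col G R (stepBound φ ρ τ K)) :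
    ∃ L W' Y' R', 1 ≤ L ∧ L ≤ 4 * ρ ∧ Chain F γ J b j (base + L) (t + 1) W' Y' R' ∧
      ¬ Col G Y' K ∧ ¬ Col G R' K := by
  obtain ⟨t₀, h1, h2⟩ := c.step_aux hr hρ hB (by omega : j < n) hY hR
  obtain ⟨L, hL, hL', ⟨m, hm, hmL, hmA⟩, ⟨m', hm', hmL', hmA'⟩⟩ :=
    exists_consecutive_links F hr hρ hB hC hω (fun z hz => c.Y_sub hz.1) hji hi h1
  obtain ⟨h3, h4⟩ := h2 (m ++ m') (by simp only [List.length_append]; omega)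
  refine ⟨L, _, _, _, hL, hL', c.extend hρ hγ hJ hji hi (A := m ++ m') (t₀ := t₀) ?_ ?_, h3, h4⟩
  · intro u hu
    rcases List.mem_append.1 hu with hu | hu
    · exact hmA u hu
    · exact hmA' u hu
  · intro e he
    by_cases het : e ≤ t
    · exact ⟨e, het, m, hm, fun u hu => List.mem_append.2 (Or.inl hu), by omega⟩
    · exact ⟨t, le_rfl, m', hm', fun u hu => List.mem_append.2 (Or.inr hu), by omega⟩

/-- One more link. -/
theorem exists_plain_step (hr : Function.Injective r) (hρ : 3 ≤ ρ)
    (hB : BallsCol G (ρ - 1) τ) (hγ : IsGate F γ) (hJ : ∀ l ∈ J, l < n)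
    (c : Chain F γ J b i base t W Y R) {j : ℕ} (hji : j < i) (hi : i < n)
    (hY : ¬ Col G Y (stepBound φ ρ τ K)) (hR : ¬ Col G R (stepBound φ ρ τ K)) :
    ∃ L W' Y' R', 1 ≤ L ∧ L ≤ 2 * ρ ∧ Chain F γ J b j (base + L) t W' Y' R' ∧
      ¬ Col G Y' K ∧ ¬ Col G R' K := by
  obtain ⟨t₀, h1, h2⟩ := c.step_aux hr hρ hB (by omega : j < n) hY hR
  obtain ⟨z, hz⟩ := nonempty_of_not_col h1
  obtain ⟨L, hL, hL', m, hm, hmL, hmA⟩ := exists_linkIn F (fun z hz => c.Y_sub hz.1) hji hi hz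
  obtain ⟨h3, h4⟩ := h2 m (by omega)
  exact ⟨L, _, _, _, hL, hL', c.extend hρ hγ hJ hji hi hmA fun e he =>
    ⟨e, he, m, hm, fun _ hu => hu, by omega⟩, h3, h4⟩

end Chain

end

section

variable {V : Type*} {G : SimpleGraph V} {ρ n : ℕ} {r : V → ℕ}

/-! ### Closing a chain to a hole -/

/-- The path which closes a chain from `v b` to `v i`, up to the neighbour `γ b z` of `v b`. -/
theorem IsGate.exists_closing_path {F : Frame G ρ r n} {γ : ℕ → V → V} (hγ : IsGate F γ)
    (hρ : 3 ≤ ρ) {i b : ℕ} (hib : i < b) (hb : b < n) {z : V} (hz : z ∈ F.D n) :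
    ∃ m, IndPath G (F.v i) (γ b z) (F.v i :: m) ∧ 2 * ρ ≤ m.length + 3 ∧ m.length + 1 ≤ 2 * ρ ∧
      ∀ u ∈ m, u = γ b z ∨ u = γ i z ∨ ∃ l < n, ∃ k, 2 ≤ k ∧ k ≤ ρ ∧ u = F.x l z k := by
  have hi : i < n := by omega
  obtain ⟨lb, hlb, hb2⟩ := hγ.adj b hb z hz
  obtain ⟨li, hli, hi2⟩ := hγ.adj i hi z hz
  have hγb : γ b z ∈ F.D b := F.B_sub b hb (hγ.mem b hb z hz)
  set Q : Set V := {u | u = F.v i ∨ u = γ i z ∨ (∃ k, 2 ≤ k ∧ k ≤ ρ ∧ u = F.x li z k) ∨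
    u = γ b z ∨ ∃ k, 2 ≤ k ∧ k ≤ ρ ∧ u = F.x lb z k}
  have hleg : ∀ l < n, (∀ k, 2 ≤ k → k ≤ ρ → F.x l z k ∈ Q) →
      Conn G Q (ρ - 2) (F.x l z 2) z := by
    intro l hl hQ
    have := Conn.of_seq (G := G) (Q := Q) (F.x l z) (by omega : 2 ≤ ρ) hQ
      (fun k _ hk => F.leg_adj l hl z hz k hk)
    rwa [F.leg_last l hl z hz] at this
  have hc : Conn G Q ((ρ - 2 + 1 + 1) + (ρ - 2 + 1)) (F.v i) (γ b z) := by
    refine Conn.trans (b := z) (Conn.step (Or.inl rfl) (hγ.hub_adj hi hz)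
      (Conn.step (Or.inr (Or.inl rfl)) hi2 (hleg li hli ?_))) (Conn.symm (Conn.step
        (Or.inr (Or.inr (Or.inr (Or.inl rfl)))) hb2 (hleg lb hlb ?_)))
    · exact fun k hk hk' => Or.inr (Or.inr (Or.inl ⟨k, hk, hk', rfl⟩))
    · exact fun k hk hk' => Or.inr (Or.inr (Or.inr (Or.inr ⟨k, hk, hk', rfl⟩)))
  obtain ⟨p, hp, hlen, hpQ⟩ := hc.exists_indPath
  -- For `ρ = 3` the distance from `v i` to `γ b z` suffices. For `ρ ≥ 4`, necessarily `lb = b`, and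
  -- the path enters `D (i + 1)` from a vertex `y` at distance at least `ρ - 1` from `v i`. Such a
  -- `y` is within `1` of `z`, so at least `ρ - 2` edges remain up to `γ b z`.
  have hlow : 2 * ρ ≤ p.length + 2 := by
    rcases Nat.eq_or_lt_of_le hρ with rfl | hρ4
    · by_contra hlt
      exact F.not_near hib hb.le hγb (hp.near_ends.mono (by omega))
    · have hlb' : lb = b := by
        rcases lt_trichotomy lb b with h | h | h
        · exact (F.not_near h hb.le hγb ((F.leg_near_hub hlb hz (by omega : 2 ≤ ρ)).trans_le
            (near_of_adj hb2.symm) (by omega))).elim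
        · exact h
        · exact ((F.not_adj_of_near_hub hρ h hlb.le (near_of_adj (hγ.hub_adj hb hz)).symm
            (F.leg_mem lb hlb z hz 2 (by omega))).2 hb2).elim
      subst hlb'
      have hD := F.D_mono (Nat.succ_le_of_lt hib) hb.le
      obtain ⟨y, hy, y', hy', hyy, hyD, hyD'⟩ := hp.exists_crossing (fun y => y ∉ F.D (i + 1))
        (fun h => F.far i hi _ h (Near.refl _ _)) (fun h => h (hD hγb))
      rw [not_not] at hyD'
      have hyi : ¬ Near G (ρ - 2) (F.v i) y := fun h =>
        F.far i hi _ hyD' (h.trans_le (near_of_adj hyy) (by omega))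
      have hγi := near_of_adj (hγ.hub_adj hi hz)
      have hyz : Near G 1 y z := by
        rcases hpQ y hy with rfl | rfl | ⟨k, hk, hk', rfl⟩ | rfl | ⟨k, hk, hk', rfl⟩
        · exact (hyi (Near.refl _ _)).elim
        · exact (hyi (hγi.mono (by omega))).elim
        · have h1 : Near G k (F.v i) (F.x li z k) :=
            (hγi.trans (near_of_adj hi2)).trans_le (F.leg_near hli hz hk hk') (by omega)
          have h2 : ρ ≤ k + 1 := by
            by_contra hlt
            exact hyi (h1.mono (by omega))
          exact (F.leg_near_last hli hz hk').mono (by omega)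
        · exact (hyD (hD hγb)).elim
        · exact (hyD (hD (F.leg_mem lb hlb z hz k hk'))).elim
      obtain ⟨s, t, hst, hs, ht⟩ := hp.near_split hy
      have h3 : ρ ≤ s + 1 := by
        by_contra hlt
        exact hyi (hs.mono (by omega))
      have h4 : ρ ≤ t + 2 := by
        by_contra hlt
        exact F.not_near hb le_rfl hz ((near_of_adj (hγ.hub_adj hb hz)).trans
          (ht.symm.trans hyz) |>.mono (by omega))
      omega
  obtain ⟨m, rfl, hm⟩ := hp.eq_cons
  rw [List.length_cons] at hlow hlen
  refine ⟨m, hp, by omega, by omega, fun u hu => ?_⟩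
  rcases hpQ u (List.mem_cons_of_mem _ hu) with rfl | h | ⟨k, hk, hk', h⟩ | h | ⟨k, hk, hk', h⟩
  · exact (hm hu).elim
  · exact Or.inr (Or.inl h)
  · exact Or.inr (Or.inr ⟨li, hli, k, hk, hk', h⟩)
  · exact Or.inl h
  · exact Or.inr (Or.inr ⟨lb, hlb, k, hk, hk', h⟩)

namespace Chain

variable {F : Frame G ρ r n} {γ : ℕ → V → V} {J : Finset ℕ} {b i base t : ℕ} {W : List V}
  {Y R : Set V}

/-- The closing path, including its edge to `v b`, has between `2 * ρ - 2` and `2 * ρ` edges. The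
window for `ℓ` thus asks the chain for between `0` and `2 * ρ + 1` edges beyond `base`, which `t`
provides. -/
theorem exists_isHole (hρ : 3 ≤ ρ) (hγ : IsGate F γ) (c : Chain F γ J b i base t W Y R)
    (hib : i < b) (hb : b < n) (hiJ : i ∈ J) (hbJ : b ∈ J) {z : V} (hz : z ∈ R) {ℓ : ℕ}
    (hℓ : base + 2 * ρ ≤ ℓ) (hℓ' : ℓ + 1 ≤ base + 4 * ρ) (ht : 2 * ρ + 1 ≤ t) :
    ∃ C : List V, C.length = ℓ ∧ G.IsHole ℓ {x | x ∈ C} := by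
  have hzD := c.R_sub hz
  have hi : i < n := by omega
  obtain ⟨m, hm, hm1, hm2, hmQ⟩ := hγ.exists_closing_path hρ hib hb hzD
  obtain ⟨l, hl, hlen, hlW⟩ := c.path (ℓ - base - (m.length + 1)) (by omega)
  have hne := F.hub_ne hib hb
  -- Every vertex of the closing path other than the two gates is within `ρ - 2` of `z`, hence has
  -- no neighbour in `W`. The gates meet `W` only at their own hubs.
  have key : ∀ w ∈ W, ∀ y ∈ m, w ≠ y ∧ (G.Adj w y → (w = F.v b ∧ y = γ b z) ∨
      (w = F.v i ∧ y = γ i z)) := by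
    intro w hw y hy
    have hg : ∀ k ∈ J, k < n → w ≠ γ k z ∧ (G.Adj w (γ k z) → w = F.v k) := by
      refine fun k hk hkn => ⟨?_, fun hadj => ?_⟩
      · rintro rfl
        exact c.far_R _ hw z hz (hγ.near hρ hkn hzD)
      · exact (c.gate w hw z hz k hk).resolve_right fun h => h hadj.symm
    rcases hmQ y hy with rfl | rfl | ⟨k, hk, a, ha, ha', rfl⟩
    · exact ⟨(hg b hbJ hb).1, fun h => Or.inl ⟨(hg b hbJ hb).2 h, rfl⟩⟩
    · exact ⟨(hg i hiJ hi).1, fun h => Or.inr ⟨(hg i hiJ hi).2 h, rfl⟩⟩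
    · have := ne_and_not_adj_of_near ((F.leg_near_last hk hzD ha').mono
        (by omega : ρ - a ≤ ρ - 2)) (c.far_R w hw z hz) (by omega)
      exact ⟨this.1.symm, fun h => (this.2 h.symm).elim⟩
  generalize hvi : F.v i = vi at hl
  cases hl with
  | single => exact (hne hvi.symm).elim
  | @cons _ b₂ _ l' hb₂ hl' h3 h4 =>
    subst hvi
    rw [List.length_cons] at hlen
    have hl'W : ∀ u ∈ l', u ∈ W := fun u hu => hlW u (List.mem_cons_of_mem _ hu)
    have hbW : F.v b ∈ W := hlW _ (List.mem_cons_self ..)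
    have hp := hl'.trans hm (fun x hx y hy => ⟨(key x (hl'W x hx) y hy).1, fun hxy => by
      rcases (key x (hl'W x hx) y hy).2 hxy with ⟨rfl, -⟩ | ⟨h5, -⟩
      · exact (h4 hx).elim
      · exact h5⟩)
    have hlen' : (l' ++ m).length + 1 = ℓ := by
      rw [List.length_append]; omega
    have hb₂m : F.v b ∉ l' ++ m := by
      intro h
      rcases List.mem_append.1 h with h | h
      · exact h4 h
      · exact (key _ hbW _ h).1 rfl
    have hole := hp.isHole (v := F.v b) (by omega) hb₂m (by
      intro y hy
      constructor
      · intro hadj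
        rcases List.mem_append.1 hy with hy | hy
        · exact Or.inl (h3 y hy hadj)
        · rcases (key _ hbW y hy).2 hadj with h | h
          · exact Or.inr h.2
          · exact (hne h.1).elim
      · rintro (rfl | rfl)
        · exact hb₂
        · exact hγ.hub_adj hb hzD)
    rw [hlen'] at hole
    refine ⟨F.v b :: (l' ++ m), by simpa using hlen', ?_⟩
    convert hole using 2 with x
    simp

theorem initial (hρ : 3 ≤ ρ) (hγ : IsGate F γ) (hJ : ∀ l ∈ J, l < n) (hb : b < n)
    (hY : Y ⊆ F.D n) (hR : R ⊆ F.D n)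
    (hlt : ∀ l ∈ J, ∀ z ∈ R, ∀ z' ∈ Y, r (γ l z) < r (γ l z')) :
    Chain F γ J b b 0 0 [F.v b] Y R where
  path := by
    intro e he
    obtain rfl : e = 0 := by omega
    exact ⟨_, IndPath.single _, rfl, fun u hu => hu⟩
  W_mem := by simpa using F.v_mem b hb
  Y_sub := hY
  R_sub := hR
  lt := hlt
  far_Y := by
    intro w hw z hz
    rw [List.mem_singleton] at hw
    exact hw ▸ F.not_near hb le_rfl (hY hz)
  far_R := by
    intro w hw z hz
    rw [List.mem_singleton] at hw
    exact hw ▸ F.not_near hb le_rfl (hR hz)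
  first := by
    intro w hw z _
    exact Or.inl (List.mem_singleton.1 hw)
  gate := by
    intro w hw z hz l hl
    rw [List.mem_singleton] at hw
    subst hw
    by_cases hlb : l = b
    · exact Or.inl (by rw [hlb])
    · exact Or.inr (hγ.not_adj_hub hρ (hJ l hl) hb hlb (hR hz))

end Chain

/-! ### Iterating the steps -/

/-- How large the reserved sets have to be in order to attach `T` links. -/
def chainBound (φ : ℕ → ℕ) (ρ τ : ℕ) : ℕ → ℕ
  | 0 => 0
  | T + 1 => stepBound φ ρ τ (chainBound φ ρ τ T)

namespace Chain

variable [Finite V] {F : Frame G ρ r n} {γ : ℕ → V → V} {J : Finset ℕ} {b i base t : ℕ}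
  {W : List V} {Y R : Set V} {φ : ℕ → ℕ} {τ M : ℕ} {h : ℕ → ℕ}

theorem exists_gadget_steps (hr : Function.Injective r) (hρ : 3 ≤ ρ)
    (hB : BallsCol G (ρ - 1) τ) (hC : BallControl G ρ φ) (hω : MaxCliques G τ)
    (hγ : IsGate F γ) (hJ : ∀ l ∈ J, l < n) (hh : ∀ k ≤ M, h k ∈ J)
    (hdec : ∀ k < M, h (k + 1) < h k) (c : Chain F γ J b (h 0) 0 0 W Y R) (s T : ℕ) (hs : s ≤ M)
    (hY : ¬ Col G Y (chainBound φ ρ τ (T + s))) (hR : ¬ Col G R (chainBound φ ρ τ (T + s))) :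
    ∃ base W' Y' R', base ≤ 4 * ρ * s ∧ Chain F γ J b (h s) base s W' Y' R' ∧
      ¬ Col G Y' (chainBound φ ρ τ T) ∧ ¬ Col G R' (chainBound φ ρ τ T) := by
  induction s generalizing T with
  | zero => exact ⟨0, W, Y, R, le_rfl, c, hY, hR⟩
  | succ s ih =>
    have hT : T + (s + 1) = T + 1 + s := by omega
    rw [hT] at hY hR
    obtain ⟨base, W', Y', R', h1, c', hY', hR'⟩ := ih (T + 1) (by omega) hY hR
    obtain ⟨L, W'', Y'', R'', -, hL, c'', hY'', hR''⟩ := c'.exists_gadget_step hr hρ hB hC hω hγ hJ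
      (hdec s (by omega)) (hJ _ (hh s (by omega))) hY' hR'
    exact ⟨_, _, _, _, by rw [Nat.mul_succ]; omega, c'', hY'', hR''⟩

/-- The target window `base + 2 * ρ ≤ ℓ < base + 4 * ρ` contains `2 * ρ` values and a link has at
most `2 * ρ` edges, so it cannot be jumped over. Every link has an edge, so `T` measures the
remaining distance. -/
theorem exists_plain_steps (hr : Function.Injective r) (hρ : 3 ≤ ρ)
    (hB : BallsCol G (ρ - 1) τ) (hγ : IsGate F γ) (hJ : ∀ l ∈ J, l < n)
    (hh : ∀ k ≤ M, h k ∈ J) (hdec : ∀ k < M, h (k + 1) < h k) {ℓ : ℕ} (T k : ℕ) (hk : k + T ≤ M)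
    (c : Chain F γ J b (h k) base t W Y R) (hℓ : base + 2 * ρ ≤ ℓ)
    (hℓ' : ℓ + 1 ≤ base + 4 * ρ + T) (hY : ¬ Col G Y (chainBound φ ρ τ T))
    (hR : ¬ Col G R (chainBound φ ρ τ T)) :
    ∃ k' base W' Y' R', k ≤ k' ∧ k' ≤ M ∧ Chain F γ J b (h k') base t W' Y' R' ∧
      base + 2 * ρ ≤ ℓ ∧ ℓ + 1 ≤ base + 4 * ρ ∧ ∃ z, z ∈ R' := by
  induction T generalizing k base W Y R with
  | zero => exact ⟨k, base, W, Y, R, le_rfl, hk, c, hℓ, hℓ', nonempty_of_not_col hR⟩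
  | succ T ih =>
    by_cases hlast : ℓ + 1 ≤ base + 4 * ρ
    · exact ⟨k, base, W, Y, R, le_rfl, by omega, c, hℓ, hlast, nonempty_of_not_col hR⟩
    · obtain ⟨L, W', Y', R', hL, hL', c', hY', hR'⟩ := c.exists_plain_step hr hρ hB hγ hJ
        (hdec k (by omega)) (hJ _ (hh k (by omega))) hY hR
      obtain ⟨k', base', W'', Y'', R'', h1, h2⟩ := ih (k + 1) (by omega) c' (by omega) (by omega)
        hY' hR'
      exact ⟨k', base', W'', Y'', R'', by omega, h2⟩

end Chain

/-! ### Separating the gates -/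

/-- How large sets have to be in order to be compared by `m` functions. -/
def sepBound (τ K : ℕ) : ℕ → ℕ
  | 0 => K
  | m + 1 => sepBound τ K m + τ + sepBound τ K m

theorem exists_separated [Finite V] {τ K : ℕ} {C : Set V} (f : ℕ → V → ℕ) (m : ℕ)
    (hf : ∀ l < m, ∀ k, Col G {z ∈ C | f l z = k} τ) {P R : Set V} (hPC : P ⊆ C)
    (hP : ¬ Col G P (sepBound τ K m)) (hR : ¬ Col G R (sepBound τ K m)) :
    ∃ P' ⊆ P, ∃ R' ⊆ R, ¬ Col G P' K ∧ ¬ Col G R' K ∧ ∀ l < m,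
      (∀ z ∈ P', ∀ z' ∈ R', f l z < f l z') ∨ ∀ z ∈ P', ∀ z' ∈ R', f l z' < f l z := by
  induction m generalizing P R with
  | zero => exact ⟨P, subset_rfl, R, subset_rfl, hP, hR, by simp⟩
  | succ m ih =>
    obtain ⟨P₁, hP₁, R₁, hR₁, hP₁', hR₁', h1⟩ := not_col_compare (b := sepBound τ K m) (f m) (f m)
      (fun k => (hf m (by omega) k).mono (fun z hz => ⟨hPC hz.1, hz.2⟩) le_rfl) hP
      (fun hc => hR (hc.mono subset_rfl (by rw [sepBound]; omega)))
    obtain ⟨P₂, hP₂, R₂, hR₂, hP₂', hR₂', h2⟩ :=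
      ih (fun l hl => hf l (by omega)) (hP₁.trans hPC) hP₁' hR₁'
    refine ⟨P₂, hP₂.trans hP₁, R₂, hR₂.trans hR₁, hP₂', hR₂', fun l hl => ?_⟩
    rcases Nat.lt_succ_iff_lt_or_eq.1 hl with h3 | rfl
    · exact h2 l h3
    · exact h1.imp (fun h z hz z' hz' => h z (hP₂ hz) z' (hR₂ hz'))
        fun h z hz z' hz' => h z (hP₂ hz) z' (hR₂ hz')

theorem exists_decreasing (M : ℕ) (J : Finset ℕ) (h : M + 1 ≤ J.card) :
    ∃ f : ℕ → ℕ, (∀ k ≤ M, f k ∈ J) ∧ ∀ k < M, f (k + 1) < f k := by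
  induction M generalizing J with
  | zero =>
    obtain ⟨j, hj⟩ := Finset.card_pos.1 h
    exact ⟨fun _ => j, fun _ _ => hj, by simp⟩
  | succ M ih =>
    have hne : J.Nonempty := Finset.card_pos.1 (by omega)
    obtain ⟨f, hf, hf'⟩ := ih (J.erase (J.max' hne)) (by
      rw [Finset.card_erase_of_mem (J.max'_mem hne)]; omega)
    refine ⟨fun k => Nat.casesOn k (J.max' hne) f, ?_, ?_⟩
    · rintro (_ | k) hk
      · exact J.max'_mem hne
      · exact Finset.mem_of_mem_erase (hf k (by omega))
    · rintro (_ | k) hk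
      · have := hf 0 (by omega)
        exact lt_of_le_of_ne (J.le_max' _ (Finset.mem_of_mem_erase this))
          (Finset.ne_of_mem_erase this)
      · exact hf' k (by omega)

theorem strictAnti_of_decreasing {f : ℕ → ℕ} {M : ℕ} (h : ∀ k < M, f (k + 1) < f k) {k : ℕ}
    (hk : 1 ≤ k) (hkM : k ≤ M) : f k < f 0 := by
  induction k, hk using Nat.le_induction with
  | base => exact h 0 (by omega)
  | succ k _ ih => exact (h k (by omega)).trans (ih (by omega))

/-! ### Holes of given length -/

/-- A graph that cannot be coloured with this number of colours has an `ℓ`-hole. -/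
def holeBound (φ : ℕ → ℕ) (ρ ℓ τ : ℕ) : ℕ :=
  frameBound φ τ (sepBound τ (chainBound φ ρ τ (ℓ + (2 * ρ + 1))) (2 * (ℓ + (2 * ρ + 1) + 1)))
    (2 * (ℓ + (2 * ρ + 1) + 1))

theorem exists_isHole [Finite V] {φ : ℕ → ℕ} {τ ℓ : ℕ} (hρ : 3 ≤ ρ)
    (hℓ : 8 * ρ ^ 2 + 6 * ρ ≤ ℓ) (hB : BallsCol G (ρ - 1) τ) (hC : BallControl G ρ φ)
    (hω : MaxCliques G τ) (h : ¬ Col G Set.univ (holeBound φ ρ ℓ τ)) :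
    ∃ C : List V, C.length = ℓ ∧ G.IsHole ℓ {x | x ∈ C} := by
  classical
  obtain ⟨r, hr⟩ : ∃ r : V → ℕ, Function.Injective r := Countable.exists_injective_nat V
  -- At most `2 * ρ + 1` double links and `ℓ` plain ones are used.
  set M := ℓ + (2 * ρ + 1)
  set K := chainBound φ ρ τ M
  obtain ⟨F, -, hF⟩ := exists_frame r hρ hB hC (sepBound τ K (2 * (M + 1))) (2 * (M + 1)) h
  obtain ⟨γ, hγ⟩ := exists_isGate F hρ
  obtain ⟨P, hPC, R, hRC, hP, hR, hsep⟩ := exists_separated (fun l z => r (γ l z)) (2 * (M + 1))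
    (fun l hl => hB.col_rank_fiber hr (γ l) fun z hz => hγ.near hρ hl hz) subset_rfl hF hF
  -- Of `2 * (M + 1)` hubs, at least `M + 1` compare the gates of `P` and `R` in the same direction;
  -- that direction decides which set becomes `Y`.
  have hJ : ∃ J : Finset ℕ, M + 1 ≤ J.card ∧ (∀ l ∈ J, l < 2 * (M + 1)) ∧ ∃ Y ⊆ F.D (2 * (M + 1)),
      ∃ R ⊆ F.D (2 * (M + 1)), ¬ Col G Y K ∧ ¬ Col G R K ∧
      ∀ l ∈ J, ∀ z ∈ R, ∀ z' ∈ Y, r (γ l z) < r (γ l z') := by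
    have hcard := Finset.card_filter_add_card_filter_not (s := Finset.range (2 * (M + 1)))
      (fun l => ∀ z ∈ P, ∀ z' ∈ R, r (γ l z) < r (γ l z'))
    rw [Finset.card_range] at hcard
    by_cases h1 : M + 1 ≤ ((Finset.range (2 * (M + 1))).filter
        (fun l => ∀ z ∈ P, ∀ z' ∈ R, r (γ l z) < r (γ l z'))).card
    · refine ⟨_, h1, fun l hl => by simpa using (Finset.mem_filter.1 hl).1, R, hRC, P, hPC, hR, hP,
        fun l hl z hz z' hz' => (Finset.mem_filter.1 hl).2 z hz z' hz'⟩
    · have h2 : M + 1 ≤ ((Finset.range (2 * (M + 1))).filter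
          (fun l => ¬ ∀ z ∈ P, ∀ z' ∈ R, r (γ l z) < r (γ l z'))).card := by omega
      refine ⟨_, h2, fun l hl => by simpa using (Finset.mem_filter.1 hl).1,
        P, hPC, R, hRC, hP, hR, fun l hl z hz z' hz' => ?_⟩
      rw [Finset.mem_filter, Finset.mem_range] at hl
      exact ((hsep l hl.1).resolve_left hl.2) z' hz' z hz
  obtain ⟨J, hJM, hJn, Y, hYC, R, hRC, hY, hR, hlt⟩ := hJ
  obtain ⟨f, hf, hf'⟩ := exists_decreasing M J hJM
  have c₀ := Chain.initial hρ hγ hJn (hJn _ (hf 0 (by omega))) hYC hRC hlt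
  obtain ⟨base, W, Y₁, R₁, hbase, c₁, hY₁, hR₁⟩ := c₀.exists_gadget_steps hr hρ hB hC hω hγ hJn hf
    hf' (2 * ρ + 1) ℓ (by omega) hY hR
  -- The bound on `ℓ` enters here: `2 * ρ + 1` links of base length at most `4 * ρ`, and `2 * ρ`
  -- more for closing.
  have hbase' : base + 2 * ρ ≤ ℓ := by
    have : 4 * ρ * (2 * ρ + 1) = 8 * ρ ^ 2 + 4 * ρ := by ring
    omega
  obtain ⟨k, base', W', Y₂, R₂, hk, hkM, c₂, h1, h2, z, hz⟩ := c₁.exists_plain_steps hr hρ hB hγ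
    hJn hf hf' ℓ (2 * ρ + 1) (by omega) hbase' (by omega) hY₁ hR₁
  exact c₂.exists_isHole hρ hγ (strictAnti_of_decreasing hf' (by omega) hkM)
    (hJn _ (hf 0 (by omega))) (hf k hkM) (hf 0 (by omega)) hz h1 h2 le_rfl

/-! ### Peripherality, and translation of the hypotheses -/

theorem BallsCol.isPeripheral {q τ d : ℕ} (hq : 1 ≤ q) (hB : BallsCol G q τ) (C : List V)
    (h : ¬ Col G Set.univ (d + C.length * τ)) : G.IsPeripheral d {x | x ∈ C} := by
  rw [IsPeripheral, ← not_le, chromaticNumber_induce_le_iff]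
  intro hc
  refine hB.not_col_far C h (hc.mono ?_ le_rfl)
  rintro x ⟨-, hx⟩
  refine ⟨fun hxC => hx x hxC (Near.refl _ _), fun u hu hadj => ?_⟩
  exact hx u hu ((near_of_adj hadj.symm).mono hq)

theorem not_col_univ_of_lt {c : ℕ} (h : (c : ℕ∞) < G.chromaticNumber) : ¬ Col G Set.univ c := by
  intro hc
  rw [← chromaticNumber_induce_le_iff, chromaticNumber_le_iff_colorable] at hc
  have := (hc.of_hom (G := G) (induceUnivIso G).symm.toHom).chromaticNumber_le
  exact not_le.2 h this

theorem ballsCol_of_ballChromaticNumber_le {q τ : ℕ}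
    (h : G.ballChromaticNumber q ≤ (τ : ℕ∞)) : BallsCol G q τ := by
  intro v
  rw [← chromaticNumber_induce_le_iff]
  exact (le_iSup (fun v => (G.induce (G.distBall q v)).chromaticNumber) v).trans h

/-- A set that is not `τ`-colourable cannot have smaller clique number, so a largest clique inside
it is a maximum clique of `G`. -/
theorem maxCliques_of_cliqueNum_lt [Finite V] {τ : ℕ}
    (h : ∀ S : Set V, (G.induce S).cliqueNum < G.cliqueNum →
      (G.induce S).chromaticNumber ≤ (τ : ℕ∞)) : MaxCliques G τ := by
  classical
  intro S hS
  rw [← chromaticNumber_induce_le_iff] at hS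
  have h1 : G.cliqueNum ≤ (G.induce S).cliqueNum := not_lt.1 fun hlt => hS (h S hlt)
  obtain ⟨K, hK⟩ := (G.induce S).exists_isNClique_cliqueNum
  have hK' := hK.map (f := Function.Embedding.subtype (· ∈ S))
  have hle : (G.induce S).map (Function.Embedding.subtype (· ∈ S)) ≤ G :=
    map_comap_le (Function.Embedding.subtype (· ∈ S)) G
  have hK'' := hK'.mono hle
  refine ⟨K.map (Function.Embedding.subtype (· ∈ S)), ?_, ?_⟩
  · intro x hx
    obtain ⟨y, -, rfl⟩ := Finset.mem_map.1 hx
    exact y.2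
  · have h2 := hK''.isClique.card_le_cliqueNum
    rw [hK''.card_eq] at h2
    rwa [le_antisymm h1 h2]

end

end PeripheralHoles







theorem mainTheorem8 (φ : ℕ → ℕ) (hφ : Monotone φ) (ρ ℓ d τ : ℕ) (hρ : 3 ≤ ρ)
    (hℓ : 8 * ρ ^ 2 + 6 * ρ ≤ ℓ) :
    ∃ c : ℕ, ∀ (V : Type*) [Finite V] (G : SimpleGraph V),
      G.IsControlled ρ φ →
      (c : ℕ∞) < G.chromaticNumber →
      G.ballChromaticNumber (ρ - 1) ≤ (τ : ℕ∞) →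
      (∀ S : Set V, (G.induce S).cliqueNum < G.cliqueNum →
        (G.induce S).chromaticNumber ≤ (τ : ℕ∞)) →
      ∃ C : Set V, G.IsHole ℓ C ∧ G.IsPeripheral d C := by
  -- The first bound yields the hole; the second leaves more than `d` colours after deleting `ℓ`
  -- balls.
  refine ⟨max (PeripheralHoles.holeBound φ ρ ℓ τ) (d + ℓ * τ), fun V _ G hC hχ hB hω => ?_⟩
  have h := PeripheralHoles.not_col_univ_of_lt hχ
  have hB' := PeripheralHoles.ballsCol_of_ballChromaticNumber_le hB
  obtain ⟨C, hlen, hhole⟩ := PeripheralHoles.exists_isHole hρ hℓ hB'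
    (PeripheralHoles.ballControl_of_isControlled hφ hC)
    (PeripheralHoles.maxCliques_of_cliqueNum_lt hω)
    (fun hc => h (hc.mono subset_rfl (le_max_left _ _)))
  refine ⟨_, hhole, hB'.isPeripheral (by omega) C fun hc => h (hc.mono subset_rfl ?_)⟩
  rw [hlen]
  exact le_max_right _ _
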